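/- Let $d(n)$ be the number of divisors of $n$, $\gamma$ Euler's constant, $K_0$, $Y_0$ the usual Bessel functions, and let $\ln$ denote the principal branch of the logarithm. For $k>0$ put $$T^{\mathrm{po}}(k):=2\pi\sum_{n=1}^{\infty}d(n)\int_0^\infty\Big[\tfrac{2}{\pi}K_0\big(4\pi\sqrt{np}\big)-Y_0\big(4\pi\sqrt{np}\big)\Big]\frac{dp}{p^2+k^2},$$ and define $$Z(s):=\exp\Big(-2\int_s^\infty k\,T^{\mathrm{po}}(k)\,dk\Big),\qquad s>0,$$ where the integrals and the series converge absolutely. Then $Z$ extends to an analytic function on $\mathbb{C}\setminus\mathbb{R}_{\le 0}$, again denoted by $Z$, for which the following holds. (i) $Z(-s)=e^{\phi(s)}Z(s)$ for all $s$ with $\operatorname{Im}s>0$, where $$\phi(s):=2\pi\Big(s\ln s+(2\gamma-1)s-\mathrm{i}\frac{\pi}{2}s+\frac{\mathrm{i}}{4}\Big).$$ (ii) For every $k>0$ the limit of $Z(-s)$ as $s\to k$, $\operatorname{Im}s>0$, exists and equals $e^{\phi(k)}Z(k)$; in this sense the functional equation also holds for $s=k\in\mathbb{R}_{>0}$. On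 the critical line, $$Z(-\mathrm{i}k)=e^{2\pi\mathrm{i}N^W(k)}Z(\mathrm{i}k),\qquad k>0,$$ where $N^W(k):=k\ln k+(2\gamma-1)k+\frac14$ is the Weyl term of the counting function $N(k)=\sum_{n\le k}d(n)$. -/

import Mathlib

open Filter Topology Set MeasureTheory

noncomputable section

namespace DirichletGraph

/-- The Bessel function `Y₀` of the second kind at a real argument `x > 0`
(Schläfli's integral). -/
def besselY0 (x : ℝ) : ℝ :=
  (1 / Real.pi) * (∫ θ in (0 : ℝ)..Real.pi, Real.sin (x * Real.sin θ))
    - (2 / Real.pi) * ∫ t in Ioi (0 : ℝ), Real.exp (-(x * Real.sinh t))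

/-- The modified Bessel function `K₀` (Macdonald function) at a real argument `x > 0`. -/
def besselK0 (x : ℝ) : ℝ :=
  ∫ t in Ioi (0 : ℝ), Real.exp (-(x * Real.cosh t))

/-- The integrand of the `n`-th term of the periodic orbit part of the trace of the
resolvent `(-Δ + k²)⁻¹`, as a function of the integration variable `p > 0`. -/
def poIntegrand (n : ℕ) (k p : ℝ) : ℝ :=
  ((2 / Real.pi) * besselK0 (4 * Real.pi * Real.sqrt (n * p))
      - besselY0 (4 * Real.pi * Real.sqrt (n * p))) * (1 / (p ^ 2 + k ^ 2))

/-- The `n`-th term, `n ≥ 1`, of the periodic orbit part of the trace of the resolvent.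
For `n = 0` it vanishes, as `Nat.divisors 0 = ∅`. -/
def poTerm (n : ℕ) (k : ℝ) : ℝ :=
  (n.divisors.card : ℝ) * ∫ p in Ioi (0 : ℝ), poIntegrand n k p

/-- The periodic orbit part `T^po(k)`, `k > 0`, of the trace of the resolvent. -/
def Tpo (k : ℝ) : ℝ :=
  2 * Real.pi * ∑' n : ℕ, poTerm n k

/-- `Z` is the periodic orbit zeta function: it is given on the positive half line by
`Z(s) = exp (-2 ∫_s^∞ k T^po(k) dk)`, and on `ℂ \ (-∞, 0]` by analytic continuation.
(Its values on `(-∞, 0]` are irrelevant.) -/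
structure IsPeriodicOrbitZeta (Z : ℂ → ℂ) : Prop where
  analytic : AnalyticOnNhd ℂ Z Complex.slitPlane
  eq_exp : ∀ s : ℝ, 0 < s →
    Z (s : ℂ) = ((Real.exp (-2 * ∫ k in Ioi s, k * Tpo k) : ℝ) : ℂ)

/-- The exponent `φ` of the functional equation (principal branch of the logarithm). -/
def phi (s : ℂ) : ℂ :=
  2 * (Real.pi : ℂ) * (s * Complex.log s + (2 * (Real.eulerMascheroniConstant : ℂ) - 1) * s
    - Complex.I * ((Real.pi : ℂ) / 2) * s + Complex.I * (1 / 4))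

/-- The Weyl term of the counting function `N(x) = ∑_{n ≤ x} d(n)` of the wavenumbers. -/
def weylN (x : ℝ) : ℝ :=
  x * Real.log x + (2 * Real.eulerMascheroniConstant - 1) * x + 1 / 4

end DirichletGraph

end

/-! Up to a constant factor, `Z s` is the product of `1 + s² / (a b)²` over `a, b ≥ 1` times `exp
(-π (s log s + (2γ - 1) s)) s^(-1/2)`. The product is even, and `log (-s) = log s - π i` in the
upper half plane, so the functional equation can be read off. The work lies in matching this
function with the definition of `Z`, which amounts to the formula `k T^po(k) = ∑_{a,b} k / (k² + (a
b)²) - (π/2) (log k + 2γ) - 1/(4k)` (`mul_Tpo` and `two_pi_mul_tsum_dualTerm`): its right side is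
half the logarithmic derivative of the explicit function.

This is a Voronoi summation formula, and three ideas prove it. The kernel `(2/π) K₀(x) - Y₀(x)`
equals `(2/π) Re (K₀(x) + K₀(i x))`, which collects the values of a holomorphic function on both
halves of the boundary of a half plane; Poisson's formula turns the `n`-th integral, times `k`, into
`2 Re K₀(4π √(n k) e^{iπ/4})` (`mul_integral_poIntegrand`).

For `n = a b` this number is a multiple of the `b`-th Fourier cosine coefficient of `rho''`, where
`rho v = exp (-2π a k / v) / v` (`mul_integral_poIntegrand_eq_dualTerm`). Summed over `b`, it gives
half the Euler-Maclaurin remainder of `∑ rho m` (`hasSum_dualTerm`).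

Summed over `a`, `rho` becomes a geometric series. By the partial fractions of the cotangent
(`rhoSum_eq`) its values at integers contain the inner sums of `∑ k / (k² + (a b)²)`. The harmonic
numbers and the regularised integral of the geometric series (`tendsto_linear_sub_log_sub_integral`)
contribute `γ` in equal parts.

Passing to `rho''` pays for convergence: by scaling, the double series is dominated by a multiple of
`1 / (k a b)²`. -/

noncomputable section

namespace DirichletGraph

/-! ### Contour shifts -/

open Complex in
theorem integral_Ioi_sub_integral_Ioi_of_differentiable {F : ℂ → ℂ} (hF : Differentiable ℂ F)
    {a b : ℝ} (hab : a ≤ b)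
    (ha : IntegrableOn (fun t : ℝ => F (t + a * I)) (Ioi 0))
    (hb : IntegrableOn (fun t : ℝ => F (t + b * I)) (Ioi 0))
    {g : ℝ → ℝ} (hg : Tendsto g atTop (𝓝 0))
    (hFg : ∀ᶠ t : ℝ in atTop, ∀ y ∈ Icc a b, ‖F (t + y * I)‖ ≤ g t) :
    (∫ t in Ioi (0 : ℝ), F (t + a * I)) - (∫ t in Ioi (0 : ℝ), F (t + b * I))
      = I * ∫ y in a..b, F (y * I) := by
  have h1 := intervalIntegral_tendsto_integral_Ioi 0 ha tendsto_id
  have h2 := intervalIntegral_tendsto_integral_Ioi 0 hb tendsto_id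
  have h3 : Tendsto (fun T : ℝ => I * ∫ y in a..b, F (T + y * I)) atTop (𝓝 0) := by
    rw [tendsto_zero_iff_norm_tendsto_zero]
    refine squeeze_zero' (Eventually.of_forall fun _ => norm_nonneg _) ?_
      (by simpa using hg.mul_const |b - a|)
    filter_upwards [hFg] with T hT
    rw [norm_mul, norm_I, one_mul]
    refine intervalIntegral.norm_integral_le_of_norm_le_const fun y hy => hT y ?_
    rw [uIoc_of_le hab] at hy
    exact ⟨hy.1.le, hy.2⟩
  have h4 : ∀ T : ℝ, (∫ t in (0:ℝ)..T, F (t + a * I)) - (∫ t in (0:ℝ)..T, F (t + b * I))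
      + I * (∫ y in a..b, F (T + y * I)) = I * ∫ y in a..b, F (y * I) := by
    intro T
    have := integral_boundary_rect_eq_zero_of_differentiableOn F (⟨0, a⟩ : ℂ) (⟨T, b⟩ : ℂ)
      hF.differentiableOn
    simp only [smul_eq_mul, ofReal_zero, zero_add] at this
    linear_combination this
  have h5 := ((h1.sub h2).add h3)
  simp only [id, h4, add_zero] at h5
  exact tendsto_nhds_unique h5 tendsto_const_nhds |>.symm ▸ rfl

open Complex in
theorem integral_eq_integral_of_differentiableOn_strip {F : ℂ → ℂ}
    {a b : ℝ} (hab : a ≤ b) (hF : DifferentiableOn ℂ F {z | z.im ∈ Icc a b})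
    (ha : Integrable (fun t : ℝ => F (t + a * I)))
    (hb : Integrable (fun t : ℝ => F (t + b * I)))
    {g : ℝ → ℝ} (hg : Tendsto g atTop (𝓝 0))
    (hFg : ∀ᶠ t : ℝ in atTop, ∀ y ∈ Icc a b, ‖F (t + y * I)‖ ≤ g t)
    {g' : ℝ → ℝ} (hg' : Tendsto g' atBot (𝓝 0))
    (hFg' : ∀ᶠ t : ℝ in atBot, ∀ y ∈ Icc a b, ‖F (t + y * I)‖ ≤ g' t) :
    (∫ t : ℝ, F (t + a * I)) = ∫ t : ℝ, F (t + b * I) := by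
  have h1 := intervalIntegral_tendsto_integral ha tendsto_neg_atTop_atBot tendsto_id
  have h2 := intervalIntegral_tendsto_integral hb tendsto_neg_atTop_atBot tendsto_id
  have h3 : Tendsto (fun T : ℝ => I * ∫ y in a..b, F (T + y * I)) atTop (𝓝 0) := by
    rw [tendsto_zero_iff_norm_tendsto_zero]
    refine squeeze_zero' (Eventually.of_forall fun _ => norm_nonneg _) ?_
      (by simpa using hg.mul_const |b - a|)
    filter_upwards [hFg] with T hT
    rw [norm_mul, norm_I, one_mul]
    refine intervalIntegral.norm_integral_le_of_norm_le_const fun y hy => hT y ?_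
    rw [uIoc_of_le hab] at hy
    exact ⟨hy.1.le, hy.2⟩
  have h3' : Tendsto (fun T : ℝ => I * ∫ y in a..b, F ((-T : ℝ) + y * I)) atTop (𝓝 0) := by
    rw [tendsto_zero_iff_norm_tendsto_zero]
    refine squeeze_zero' (Eventually.of_forall fun _ => norm_nonneg _) ?_
      (by simpa using (hg'.comp tendsto_neg_atTop_atBot).mul_const |b - a|)
    filter_upwards [tendsto_neg_atTop_atBot.eventually hFg'] with T hT
    rw [norm_mul, norm_I, one_mul]
    refine intervalIntegral.norm_integral_le_of_norm_le_const fun y hy => hT y ?_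
    rw [uIoc_of_le hab] at hy
    exact ⟨hy.1.le, hy.2⟩
  have h4 : ∀ T : ℝ, (∫ t in (-T)..T, F (t + a * I)) - (∫ t in (-T)..T, F (t + b * I))
      + I * (∫ y in a..b, F (T + y * I)) - I * (∫ y in a..b, F ((-T : ℝ) + y * I)) = 0 := by
    intro T
    have := integral_boundary_rect_eq_zero_of_differentiableOn F (⟨-T, a⟩ : ℂ) (⟨T, b⟩ : ℂ)
      (hF.mono (by
        intro z hz
        rw [mem_reProdIm] at hz
        simpa [uIcc_of_le hab] using hz.2))
    simp only [smul_eq_mul] at this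
    linear_combination this
  have h5 := (((h1.sub h2).add h3).sub h3')
  simp only [id, h4, add_zero, sub_zero] at h5
  exact (sub_eq_zero.mp (tendsto_nhds_unique h5 tendsto_const_nhds))

/-! ### The Macdonald function on rotated paths -/

theorem integrableOn_exp_neg_mul_sinh {c : ℝ} (hc : 0 < c) :
    IntegrableOn (fun t : ℝ => Real.exp (-(c * Real.sinh t))) (Ioi 0) := by
  refine (integrableOn_exp_mul_Ioi (neg_lt_zero.2 hc) 0).mono'
    (by fun_prop : Continuous fun t : ℝ => Real.exp (-(c * Real.sinh t))).aestronglyMeasurable ?_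
  refine (ae_restrict_mem measurableSet_Ioi).mono fun t ht => ?_
  rw [Real.norm_of_nonneg (Real.exp_pos _).le, Real.exp_le_exp, neg_mul, neg_le_neg_iff]
  exact mul_le_mul_of_nonneg_left (Real.self_le_sinh_iff.2 (le_of_lt ht)) hc.le

/-- `∫₀^∞ exp (-z cosh (t - i α)) dt - i ∫₀^α exp (-z cos θ) dθ`: the integral of
`exp (-z cosh τ)` along the path from `0` to `-i α` to `∞ - i α`. -/
def macdonald (z : ℂ) (α : ℝ) : ℂ :=
  (∫ t in Ioi (0 : ℝ), Complex.exp (-(z * Complex.cosh (t + (-α : ℝ) * Complex.I))))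
    - Complex.I * ∫ θ in (0 : ℝ)..α, Complex.exp (-(z * Real.cos θ))

/-- This decides which angles give a convergent integral. At `α = π / 4` both trigonometric factors
are positive, so a single path serves positive `z`, positive multiples of `i`, and the directions
between them. -/
theorem re_mul_cosh (z : ℂ) (t α : ℝ) :
    (z * Complex.cosh (t + (-α : ℝ) * Complex.I)).re
      = z.re * Real.cos α * Real.cosh t + z.im * Real.sin α * Real.sinh t := by
  have : Complex.cosh (t + (-α : ℝ) * Complex.I) =
      ((Real.cosh t * Real.cos α : ℝ) : ℂ) - ((Real.sinh t * Real.sin α : ℝ) : ℂ) * Complex.I := by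
    rw [Complex.cosh_add, Complex.cosh_mul_I, Complex.sinh_mul_I]
    push_cast
    rw [Complex.cos_neg, Complex.sin_neg]
    ring
  rw [this, Complex.mul_re, Complex.sub_re, Complex.sub_im, Complex.re_ofReal_mul,
    Complex.im_ofReal_mul, Complex.ofReal_re, Complex.ofReal_im, Complex.I_re, Complex.I_im]
  ring

theorem norm_exp_neg_mul_cosh_le {z : ℂ} {α c : ℝ} (h0 : 0 ≤ z.re * Real.cos α)
    (h1 : c ≤ z.re * Real.cos α + z.im * Real.sin α) {t : ℝ} (ht : 0 ≤ t) :
    ‖Complex.exp (-(z * Complex.cosh (t + (-α : ℝ) * Complex.I)))‖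
      ≤ Real.exp (-(c * Real.sinh t)) := by
  rw [Complex.norm_exp, Complex.neg_re, re_mul_cosh, Real.exp_le_exp, neg_le_neg_iff]
  have h2 : Real.sinh t ≤ Real.cosh t := (Real.sinh_lt_cosh t).le
  have h3 : 0 ≤ Real.sinh t := Real.sinh_nonneg_iff.mpr ht
  nlinarith [mul_le_mul_of_nonneg_left h2 h0, mul_le_mul_of_nonneg_right h1 h3]

theorem integrableOn_exp_neg_mul_cosh {z : ℂ} {α c : ℝ} (hc : 0 < c) (h0 : 0 ≤ z.re * Real.cos α)
    (h1 : c ≤ z.re * Real.cos α + z.im * Real.sin α) :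
    IntegrableOn (fun t : ℝ =>
      Complex.exp (-(z * Complex.cosh (t + (-α : ℝ) * Complex.I)))) (Ioi 0) := by
  refine (integrableOn_exp_neg_mul_sinh hc).mono' ?_ ?_
  · exact (by fun_prop : Continuous (fun t : ℝ =>
      Complex.exp (-(z * Complex.cosh (t + (-α : ℝ) * Complex.I))))).aestronglyMeasurable
  · exact (ae_restrict_mem measurableSet_Ioi).mono fun t ht =>
      norm_exp_neg_mul_cosh_le h0 h1 (le_of_lt ht)

/-- Cauchy's theorem: the difference of the two half-line integrals is the integral over the segment
joining their starting points, which the finite integrals absorb. The uniform `c` makes the far side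
vanish. -/
theorem macdonald_eq_of_le {z : ℂ} {α₀ α₁ c : ℝ} (hα : α₀ ≤ α₁) (hc : 0 < c)
    (h0 : ∀ α ∈ Icc α₀ α₁, 0 ≤ z.re * Real.cos α)
    (h1 : ∀ α ∈ Icc α₀ α₁, c ≤ z.re * Real.cos α + z.im * Real.sin α) :
    macdonald z α₁ = macdonald z α₀ := by
  have key := integral_Ioi_sub_integral_Ioi_of_differentiable
    (F := fun τ => Complex.exp (-(z * Complex.cosh τ))) (by fun_prop)
    (neg_le_neg hα)
    (integrableOn_exp_neg_mul_cosh hc (h0 _ (right_mem_Icc.2 hα)) (h1 _ (right_mem_Icc.2 hα)))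
    (integrableOn_exp_neg_mul_cosh hc (h0 _ (left_mem_Icc.2 hα)) (h1 _ (left_mem_Icc.2 hα)))
    (g := fun t => Real.exp (-(c * t))) ?_ ?_
  · have e1 : (∫ y in (-α₁)..(-α₀), Complex.exp (-(z * Complex.cosh (y * Complex.I))))
        = ∫ θ in α₀..α₁, Complex.exp (-(z * Real.cos θ)) := by
      rw [← intervalIntegral.integral_comp_neg]
      refine intervalIntegral.integral_congr fun y _ => ?_
      simp [Complex.cosh_mul_I]
    have hi : ∀ a b : ℝ, IntervalIntegrable (fun θ : ℝ => Complex.exp (-(z * Real.cos θ)))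
        volume a b := fun a b => (by fun_prop : Continuous (fun θ : ℝ =>
          Complex.exp (-(z * Real.cos θ)))).intervalIntegrable a b
    have e2 := intervalIntegral.integral_add_adjacent_intervals (hi 0 α₀) (hi α₀ α₁)
    rw [e1] at key
    unfold macdonald
    rw [← e2]
    linear_combination key
  · have : Tendsto (fun t : ℝ => c * t) atTop atTop := tendsto_id.const_mul_atTop hc
    exact Real.tendsto_exp_neg_atTop_nhds_zero.comp this
  · filter_upwards [eventually_ge_atTop 0] with t ht y hy
    have hy' : -y ∈ Icc α₀ α₁ := ⟨by linarith [hy.2], by linarith [hy.1]⟩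
    have := norm_exp_neg_mul_cosh_le (h0 _ hy') (h1 _ hy') ht
    rw [neg_neg] at this
    refine this.trans (Real.exp_le_exp.2 (neg_le_neg ?_))
    exact mul_le_mul_of_nonneg_left (Real.self_le_sinh_iff.2 ht) hc.le

theorem macdonald_zero (z : ℂ) :
    macdonald z 0 = ∫ t in Ioi (0 : ℝ), Complex.exp (-(z * Real.cosh t)) := by
  simp [macdonald]

/-- `exp (i π / 4)` -/
def rotor : ℂ := ⟨√2 / 2, √2 / 2⟩

theorem sqrt_two_div_two_le_cos {α : ℝ} (h0 : 0 ≤ α) (h1 : α ≤ Real.pi / 4) :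
    √2 / 2 ≤ Real.cos α := by
  rw [← Real.cos_pi_div_four]
  exact Real.cos_le_cos_of_nonneg_of_le_pi h0 (by linarith [Real.pi_pos]) h1

theorem macdonald_ofReal {r : ℝ} (hr : 0 < r) :
    macdonald r (Real.pi / 4) = besselK0 r := by
  have hs : 0 < √2 / 2 := by positivity
  rw [macdonald_eq_of_le (α₀ := 0) (c := r * (√2 / 2)) (by positivity) (by positivity),
    macdonald_zero, besselK0, ← integral_complex_ofReal]
  · push_cast
    rfl
  · intro α hα
    have := sqrt_two_div_two_le_cos hα.1 hα.2
    simp only [Complex.ofReal_re]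
    nlinarith
  · intro α hα
    have := sqrt_two_div_two_le_cos hα.1 hα.2
    simp only [Complex.ofReal_re, Complex.ofReal_im, zero_mul, add_zero]
    nlinarith

theorem integral_sin_mul_sin (r : ℝ) :
    ∫ θ in (0 : ℝ)..Real.pi, Real.sin (r * Real.sin θ)
      = 2 * ∫ θ in (0 : ℝ)..(Real.pi / 2), Real.sin (r * Real.cos θ) := by
  have hi : ∀ a b : ℝ, IntervalIntegrable (fun θ : ℝ => Real.sin (r * Real.sin θ)) volume a b :=
    fun a b => (by fun_prop : Continuous (fun θ : ℝ =>
      Real.sin (r * Real.sin θ))).intervalIntegrable a b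
  rw [← intervalIntegral.integral_add_adjacent_intervals (hi 0 (Real.pi / 2)) (hi _ _), two_mul]
  congr 1
  · have := intervalIntegral.integral_comp_sub_left (a := 0) (b := Real.pi / 2)
      (fun θ => Real.sin (r * Real.sin θ)) (Real.pi / 2)
    simp only [sub_self, sub_zero, Real.sin_pi_div_two_sub] at this
    exact this.symm
  · have := intervalIntegral.integral_comp_add_right (a := 0) (b := Real.pi / 2)
      (fun θ => Real.sin (r * Real.sin θ)) (Real.pi / 2)
    simp only [Real.sin_add_pi_div_two, zero_add, add_halves] at this
    exact this.symm

/-- At `α = π / 2` the exponential becomes the real `exp (-r sinh t)`, and the finite part has real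
part minus the sine integral; together they are Schläfli's formula. -/
theorem re_macdonald_I_mul {r : ℝ} (hr : 0 < r) :
    (macdonald (r * Complex.I) (Real.pi / 4)).re = -(Real.pi / 2) * besselY0 r := by
  have hs : 0 < √2 / 2 := by positivity
  have hpi := Real.pi_pos
  rw [← macdonald_eq_of_le (α₁ := Real.pi / 2) (c := r * (√2 / 2)) (by linarith) (by positivity)]
  · have e1 : (∫ t in Ioi (0 : ℝ), Complex.exp (-(r * Complex.I *
        Complex.cosh (t + (-(Real.pi / 2) : ℝ) * Complex.I))))
        = ((∫ t in Ioi (0 : ℝ), Real.exp (-(r * Real.sinh t)) : ℝ) : ℂ) := by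
      rw [← integral_complex_ofReal]
      refine integral_congr_ae (Eventually.of_forall fun t => ?_)
      simp only
      rw [Complex.cosh_add, Complex.cosh_mul_I, Complex.sinh_mul_I]
      push_cast
      rw [Complex.cos_neg, Complex.sin_neg, Complex.cos_pi_div_two, Complex.sin_pi_div_two]
      congr 2
      linear_combination (-(r * Complex.sinh t)) * Complex.I_mul_I
    have e2 : (∫ θ in (0 : ℝ)..(Real.pi / 2), Complex.exp (-(r * Complex.I * Real.cos θ)))
        = ((∫ θ in (0 : ℝ)..(Real.pi / 2), Real.cos (r * Real.cos θ) : ℝ) : ℂ)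
          - ((∫ θ in (0 : ℝ)..(Real.pi / 2), Real.sin (r * Real.cos θ) : ℝ) : ℂ) * Complex.I := by
      rw [← intervalIntegral.integral_ofReal, ← intervalIntegral.integral_ofReal,
        ← intervalIntegral.integral_mul_const, ← intervalIntegral.integral_sub]
      · refine intervalIntegral.integral_congr fun θ _ => ?_
        rw [show -(r * Complex.I * (Real.cos θ : ℂ)) = ((-(r * Real.cos θ) : ℝ) : ℂ) * Complex.I by
          push_cast; ring, Complex.exp_mul_I, ← Complex.ofReal_cos, ← Complex.ofReal_sin,
          Real.cos_neg, Real.sin_neg]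
        push_cast
        ring
      · exact (by fun_prop : Continuous fun θ : ℝ =>
          ((Real.cos (r * Real.cos θ) : ℝ) : ℂ)).intervalIntegrable _ _
      · exact (by fun_prop : Continuous fun θ : ℝ =>
          ((Real.sin (r * Real.cos θ) : ℝ) : ℂ) * Complex.I).intervalIntegrable _ _
    rw [macdonald, e1, e2, besselY0, integral_sin_mul_sin]
    simp
    field_simp
    ring
  · intro α hα
    simp
  · intro α hα
    have : √2 / 2 ≤ Real.sin α := by
      rw [← Real.cos_pi_div_two_sub]
      exact sqrt_two_div_two_le_cos (by linarith [hα.2]) (by linarith [hα.1])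
    simp
    nlinarith

theorem macdonald_rotor_mul {r : ℝ} (hr : 0 < r) :
    macdonald (r * rotor) (Real.pi / 4)
      = ∫ t in Ioi (0 : ℝ), Complex.exp (-(r * rotor * Real.cosh t)) := by
  have hs : 0 < √2 / 2 := by positivity
  rw [macdonald_eq_of_le (α₀ := 0) (c := r * (√2 / 2) * (√2 / 2)) (by positivity) (by positivity),
    macdonald_zero]
  · intro α hα
    have := sqrt_two_div_two_le_cos hα.1 hα.2
    have h2 : 0 ≤ Real.cos α := hs.le.trans this
    simp only [Complex.re_ofReal_mul, rotor]
    positivity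
  · intro α hα
    have h1 := sqrt_two_div_two_le_cos hα.1 hα.2
    have h2 : 0 ≤ Real.sin α :=
      Real.sin_nonneg_of_nonneg_of_le_pi hα.1 (by linarith [hα.2, Real.pi_pos])
    simp only [Complex.re_ofReal_mul, Complex.im_ofReal_mul, rotor]
    have h3 := mul_le_mul_of_nonneg_left h1 (by positivity : 0 ≤ r * (√2 / 2))
    have h4 : 0 ≤ r * (√2 / 2) * Real.sin α := by positivity
    linarith

/-! ### The substitution `y = exp t` and Poisson's formula in a quadrant -/

section ExpSubstitution
variable {E : Type*} [NormedAddCommGroup E] [NormedSpace ℝ E]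

theorem integral_exp_smul_comp_exp (g : ℝ → E) :
    ∫ t : ℝ, Real.exp t • g (Real.exp t) = ∫ y in Ioi (0 : ℝ), g y := by
  have := integral_image_eq_integral_abs_deriv_smul (s := univ) MeasurableSet.univ
    (fun x _ => (Real.hasDerivAt_exp x).hasDerivWithinAt) Real.exp_injective.injOn g
  rw [image_univ, Real.range_exp] at this
  rw [this, setIntegral_univ]
  simp

theorem integrable_exp_smul_comp_exp_iff (g : ℝ → E) :
    Integrable (fun t : ℝ => Real.exp t • g (Real.exp t)) ↔ IntegrableOn g (Ioi 0) := by
  have := integrableOn_image_iff_integrableOn_abs_deriv_smul (s := univ) MeasurableSet.univ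
    (fun x _ => (Real.hasDerivAt_exp x).hasDerivWithinAt) Real.exp_injective.injOn g
  rw [image_univ, Real.range_exp] at this
  rw [this, integrableOn_univ]
  simp

end ExpSubstitution

theorem rotor_sq : rotor ^ 2 = Complex.I := by
  have h : √2 / 2 * (√2 / 2) = 1 / 2 := by
    have := Real.mul_self_sqrt (show (0:ℝ) ≤ 2 by norm_num)
    linear_combination this / 4
  rw [pow_two]
  apply Complex.ext
  · simp [rotor]
  · simp only [rotor, Complex.mul_im, Complex.I_im, h]
    norm_num

/-- The weight `2 y / (y ^ 4 + k ^ 2)` which `dp / (p ^ 2 + k ^ 2)` becomes for `p = y ^ 2`. -/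
def weight (k y : ℝ) : ℝ := 2 * y / (y ^ 4 + k ^ 2)

section weight
variable {k : ℝ} (hk : 0 < k)
include hk

theorem continuous_weight : Continuous (weight k) := by
  unfold weight
  exact Continuous.div (by fun_prop) (by fun_prop) fun y => by positivity

theorem hasDerivAt_arctan_sq_div (y : ℝ) :
    HasDerivAt (fun y : ℝ => Real.arctan (y ^ 2 / k) / k) (weight k y) y := by
  have h := (((hasDerivAt_pow 2 y).div_const k).arctan).div_const k
  convert! h using 1
  unfold weight
  field_simp
  ring

theorem tendsto_arctan_sq_div :
    Tendsto (fun y : ℝ => Real.arctan (y ^ 2 / k) / k) atTop (𝓝 (Real.pi / (2 * k))) := by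
  have h1 : Tendsto (fun y : ℝ => y ^ 2 / k) atTop atTop :=
    (tendsto_pow_atTop two_ne_zero).atTop_div_const hk
  have h2 := (tendsto_nhds_of_tendsto_nhdsWithin Real.tendsto_arctan_atTop).comp h1
  have h3 := h2.div_const k
  rwa [div_div] at h3

theorem weight_nonneg {y : ℝ} (hy : 0 ≤ y) : 0 ≤ weight k y := by
  unfold weight; positivity

theorem integrableOn_weight : IntegrableOn (weight k) (Ioi 0) :=
  integrableOn_Ioi_deriv_of_nonneg' (fun y _ => hasDerivAt_arctan_sq_div hk y)
    (fun _ hy => weight_nonneg hk (le_of_lt hy)) (tendsto_arctan_sq_div hk)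

theorem integral_weight : ∫ y in Ioi (0 : ℝ), weight k y = Real.pi / (2 * k) := by
  rw [integral_Ioi_of_hasDerivAt_of_nonneg' (fun y _ => hasDerivAt_arctan_sq_div hk y)
    (fun _ hy => weight_nonneg hk (le_of_lt hy)) (tendsto_arctan_sq_div hk)]
  simp

/-- The factor `1 / y` comes from the crude bound `exp_neg_mul_sinh_le` near the logarithmic
singularity of `K₀`; the weight vanishes linearly there. -/
theorem integrableOn_weight_div : IntegrableOn (fun y => weight k y * (1 / y)) (Ioi 0) := by
  have h : Integrable fun y : ℝ => (2 * (1 + 2 / k ^ 2)) * (1 + y ^ 2)⁻¹ :=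
    integrable_inv_one_add_sq.const_mul _
  refine h.integrableOn.mono' ?_ ?_
  · exact ((continuous_weight hk).measurable.mul (by fun_prop)).aestronglyMeasurable
  · refine (ae_restrict_mem measurableSet_Ioi).mono fun y hy => ?_
    have hy : 0 < y := hy
    rw [Real.norm_of_nonneg (mul_nonneg (weight_nonneg hk hy.le) (by positivity))]
    unfold weight
    rw [← div_eq_mul_inv, div_mul_div_comm, div_le_div_iff₀ (by positivity) (by positivity)]
    have h1 : 2 * (1 + 2 / k ^ 2) * ((y ^ 4 + k ^ 2) * y)
        = 2 * y * (y ^ 4 + k ^ 2 + 2 * y ^ 4 / k ^ 2 + 2) := by field_simp; ring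
    rw [h1, mul_one]
    have h2 : 0 ≤ 2 * y ^ 4 / k ^ 2 := by positivity
    refine mul_le_mul_of_nonneg_left ?_ (by positivity)
    nlinarith [sq_nonneg (y ^ 2 - 1), sq_nonneg k]

end weight

/-- Poisson's formula for a half plane, for `exp (-lam √w)` at the point `w = i k`. -/
theorem integral_weight_mul_exp {k : ℝ} (hk : 0 < k) {lam : ℂ} (hre : 0 ≤ lam.re)
    (him : lam.im ≤ 0) :
    ∫ y in Ioi (0 : ℝ), (weight k y : ℂ) *
        (Complex.exp (-(lam * y)) + Complex.exp (-(lam * (y * Complex.I))))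
      = (Real.pi / k : ℝ) * Complex.exp (-(lam * (√k * rotor))) := by
  set ζ₀ : ℂ := √k * rotor with hζ₀
  have hζsq : ζ₀ ^ 2 = k * Complex.I := by
    rw [hζ₀, mul_pow, rotor_sq, ← Complex.ofReal_pow, Real.sq_sqrt hk.le]
  have hsk : 0 < √k := Real.sqrt_pos.2 hk
  have hs2 : 0 < √2 / 2 := by positivity
  have hζre : 0 < ζ₀.re := by simp only [hζ₀, Complex.re_ofReal_mul, rotor]; positivity
  have hζim : 0 < ζ₀.im := by simp only [hζ₀, Complex.im_ofReal_mul, rotor]; positivity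
  set c₀ := Complex.exp (-(lam * ζ₀)) with hc₀
  have hbd : ∀ ζ : ℂ, 0 ≤ ζ.re → 0 ≤ ζ.im → ‖Complex.exp (-(lam * ζ))‖ ≤ 1 := by
    intro ζ h1 h2
    rw [Complex.norm_exp, Real.exp_le_one_iff, Complex.neg_re, Complex.mul_re]
    nlinarith [mul_nonneg hre h1, mul_nonneg (neg_nonneg.2 him) h2]
  -- Subtracting the constant `c₀` removes the pole at `ζ₀`, the only one in the quadrant, so that
  -- no residue is needed.
  set D := dslope (fun ζ => Complex.exp (-(lam * ζ))) ζ₀ with hD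
  have hDdiff : Differentiable ℂ D := by
    rw [← differentiableOn_univ, hD, Complex.differentiableOn_dslope univ_mem]
    exact Differentiable.differentiableOn (by fun_prop)
  -- The form `2 ζ (exp (-lam ζ) - c₀) / (ζ ^ 4 + k ^ 2) dζ` in the variable `ζ = exp τ`; the
  -- quadrant becomes a strip. The remaining poles `-ζ₀`, `± i ζ₀` lie outside the closed quadrant.
  set F : ℂ → ℂ := fun τ => 2 * Complex.exp τ ^ 2 * D (Complex.exp τ) /
    ((Complex.exp τ + ζ₀) * (Complex.exp τ ^ 2 + ζ₀ ^ 2)) with hF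
  have hFval : ∀ τ, Complex.exp τ ≠ ζ₀ → F τ = 2 * Complex.exp τ ^ 2 *
      (Complex.exp (-(lam * Complex.exp τ)) - c₀) / (Complex.exp τ ^ 4 + k ^ 2) := by
    intro τ hτ
    have h1 : Complex.exp τ ^ 4 + k ^ 2 =
        (Complex.exp τ - ζ₀) * ((Complex.exp τ + ζ₀) * (Complex.exp τ ^ 2 + ζ₀ ^ 2)) := by
      linear_combination (k : ℂ) ^ 2 * Complex.I_sq + (k * Complex.I + ζ₀ ^ 2) * hζsq
    have h2 : Complex.exp τ - ζ₀ ≠ 0 := sub_ne_zero.2 hτ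
    rw [hF, h1]
    simp only [hD]
    rw [dslope_of_ne _ hτ, slope_def_field, ← mul_div_assoc, div_div]
  have hquad : ∀ (t y : ℝ), y ∈ Icc 0 (Real.pi / 2) →
      0 ≤ (Complex.exp (t + y * Complex.I)).re ∧ 0 ≤ (Complex.exp (t + y * Complex.I)).im := by
    intro t y hy
    rw [Complex.exp_re, Complex.exp_im]
    have h1 := Real.cos_nonneg_of_mem_Icc (x := y) ⟨by linarith [hy.1, Real.pi_pos], hy.2⟩
    have h2 := Real.sin_nonneg_of_nonneg_of_le_pi hy.1 (by linarith [hy.2, Real.pi_pos])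
    simp only [Complex.add_re, Complex.add_im, Complex.ofReal_re, Complex.ofReal_im,
      Complex.re_ofReal_mul, Complex.im_ofReal_mul, Complex.I_re, Complex.I_im, mul_zero, mul_one,
      add_zero, zero_add]
    exact ⟨by positivity, by positivity⟩
  have hdiff : DifferentiableOn ℂ F {z | z.im ∈ Icc 0 (Real.pi / 2)} := by
    intro τ hτ
    obtain ⟨h1, h2⟩ := hquad τ.re τ.im hτ
    rw [Complex.re_add_im] at h1 h2
    refine DifferentiableAt.differentiableWithinAt (DifferentiableAt.div ?_ (by fun_prop) ?_)
    · exact ((by fun_prop : DifferentiableAt ℂ (fun τ => 2 * Complex.exp τ ^ 2) τ)).mul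
        ((hDdiff _).comp τ Complex.differentiableAt_exp)
    · refine mul_ne_zero (fun h => ?_) (fun h => ?_)
      · have := congrArg Complex.re h
        simp only [Complex.add_re, Complex.zero_re] at this
        linarith
      · have := congrArg Complex.im h
        rw [hζsq] at this
        simp [pow_two] at this
        nlinarith [mul_nonneg h1 h2]
  have hnorm : ∀ (t y : ℝ), ‖Complex.exp (t + y * Complex.I)‖ = Real.exp t := by
    intro t y; simp [Complex.norm_exp]
  have hc₀le : ‖c₀‖ ≤ 1 := hbd _ hζre.le hζim.le
  have hζn : ‖ζ₀‖ ^ 2 = k := by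
    rw [← norm_pow, hζsq]; simp [abs_of_pos hk]
  have hbound : ∀ (t y m : ℝ), y ∈ Icc 0 (Real.pi / 2) → 0 < m →
      m ≤ |Real.exp t ^ 4 - k ^ 2| → ‖F (t + y * Complex.I)‖ ≤ 4 * Real.exp t ^ 2 / m := by
    intro t y m hy hm hle
    have hne : Complex.exp (t + y * Complex.I) ≠ ζ₀ := by
      intro h
      have h1 : Real.exp t ^ 2 = k := by rw [← hnorm t y, h, hζn]
      have h2 : Real.exp t ^ 4 - k ^ 2 = 0 := by rw [← h1]; ring
      rw [h2, abs_zero] at hle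
      linarith
    rw [hFval _ hne, norm_div]
    obtain ⟨h1, h2⟩ := hquad t y hy
    refine div_le_div₀ (by positivity) ?_ hm ?_
    · rw [norm_mul, norm_mul, norm_pow, hnorm, Complex.norm_two]
      have := (norm_sub_le (Complex.exp (-(lam * Complex.exp (t + y * Complex.I)))) c₀).trans
        (add_le_add (hbd _ h1 h2) hc₀le)
      nlinarith [mul_le_mul_of_nonneg_left this (by positivity : 0 ≤ 2 * Real.exp t ^ 2)]
    · refine hle.trans ?_
      have := abs_norm_sub_norm_le (Complex.exp (t + y * Complex.I) ^ 4) (-((k : ℂ) ^ 2))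
      rw [norm_pow, hnorm, norm_neg, norm_pow, Complex.norm_real, Real.norm_eq_abs, sq_abs,
        sub_neg_eq_add] at this
      exact this
  have hexp4 : ∀ t : ℝ, Real.exp t ^ 4 = Real.exp (4 * t) := fun t => by
    rw [← Real.exp_nat_mul]; norm_num
  have hexp2 : ∀ t : ℝ, Real.exp t ^ 2 = Real.exp (2 * t) := fun t => by
    rw [← Real.exp_nat_mul]; norm_num
  have e0 : ∀ t : ℝ, F (t + (0 : ℝ) * Complex.I) = Real.exp t •
      ((weight k (Real.exp t) : ℂ) * (Complex.exp (-(lam * Real.exp t)) - c₀)) := by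
    intro t
    rw [Complex.ofReal_zero, zero_mul, add_zero, hFval, weight]
    · rw [Complex.real_smul]; push_cast; ring
    · intro h
      have := congrArg Complex.im h
      rw [← Complex.ofReal_exp, Complex.ofReal_im] at this
      linarith
  -- On the imaginary axis `ζ ^ 2 = -y ^ 2`. This sign turns the equality of the two edge integrals
  -- into the vanishing of a sum.
  have e1 : ∀ t : ℝ, F (t + (Real.pi / 2 : ℝ) * Complex.I) = Real.exp t •
      (-((weight k (Real.exp t) : ℂ) *
        (Complex.exp (-(lam * (Real.exp t * Complex.I))) - c₀))) := by
    intro t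
    have h : Complex.exp (t + (Real.pi / 2 : ℝ) * Complex.I) = Real.exp t * Complex.I := by
      rw [Complex.exp_add, Complex.exp_mul_I, ← Complex.ofReal_cos, ← Complex.ofReal_sin,
        Real.cos_pi_div_two, Real.sin_pi_div_two]
      simp
    rw [hFval, weight, h]
    · rw [Complex.real_smul, mul_pow, mul_pow, Complex.I_sq, Complex.I_pow_four]; push_cast; ring
    · rw [h]; intro h
      have := congrArg Complex.re h
      rw [Complex.re_ofReal_mul, Complex.I_re, mul_zero] at this
      linarith
  have hint : ∀ ω : ℂ, 0 ≤ ω.re → 0 ≤ ω.im → IntegrableOn (fun y : ℝ => (weight k y : ℂ) *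
      (Complex.exp (-(lam * (y * ω))) - c₀)) (Ioi 0) := by
    intro ω h1 h2
    refine ((integrableOn_weight hk).mul_const 2).mono' ?_ ?_
    · refine Continuous.aestronglyMeasurable ?_
      have := continuous_weight hk
      fun_prop
    · refine (ae_restrict_mem measurableSet_Ioi).mono fun y hy => ?_
      have hy : 0 < y := hy
      rw [norm_mul, Complex.norm_real, Real.norm_of_nonneg (weight_nonneg hk hy.le)]
      refine mul_le_mul_of_nonneg_left ?_ (weight_nonneg hk hy.le)
      refine (norm_sub_le _ _).trans ?_
      have := hbd (y * ω) (by simp; positivity) (by simp; positivity)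
      linarith
  have hint0 := hint 1 (by simp) (by simp)
  have hintI := hint Complex.I (by simp) (by simp)
  simp only [mul_one] at hint0
  have key := integral_eq_integral_of_differentiableOn_strip (F := F) (by positivity) hdiff
    (by simp only [e0]; exact (integrable_exp_smul_comp_exp_iff _).2 hint0)
    (by simp only [e1]; exact (integrable_exp_smul_comp_exp_iff _).2 hintI.neg)
    (g := fun t => 8 * Real.exp (-(2 * t))) ?_ ?_
    (g' := fun t => 8 / k ^ 2 * Real.exp (2 * t)) ?_ ?_
  · simp only [e0, e1] at key
    rw [integral_exp_smul_comp_exp (fun y : ℝ => (weight k y : ℂ) *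
        (Complex.exp (-(lam * y)) - c₀)),
      integral_exp_smul_comp_exp (fun y : ℝ => -((weight k y : ℂ) *
        (Complex.exp (-(lam * (y * Complex.I))) - c₀))), integral_neg, ← add_eq_zero_iff_eq_neg,
      ← integral_add hint0 hintI] at key
    -- What was subtracted is `2 c₀` times the total mass `π / (2 k)` of the weight, which is the
    -- right-hand side.
    have hw : Integrable (fun y : ℝ => (weight k y : ℂ) * (2 * c₀))
        (volume.restrict (Ioi 0)) := ((integrableOn_weight hk).ofReal (𝕜 := ℂ)).mul_const _
    have hadd : Integrable (fun y : ℝ => (weight k y : ℂ) * (Complex.exp (-(lam * y)) - c₀)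
        + (weight k y : ℂ) * (Complex.exp (-(lam * (y * Complex.I))) - c₀))
        (volume.restrict (Ioi 0)) := hint0.add hintI
    calc ∫ y in Ioi (0 : ℝ), (weight k y : ℂ) *
          (Complex.exp (-(lam * y)) + Complex.exp (-(lam * (y * Complex.I))))
        = ∫ y in Ioi (0 : ℝ), (((weight k y : ℂ) * (Complex.exp (-(lam * y)) - c₀)
            + (weight k y : ℂ) * (Complex.exp (-(lam * (y * Complex.I))) - c₀))
            + (weight k y : ℂ) * (2 * c₀)) := by
          refine integral_congr_ae (Eventually.of_forall fun y => ?_)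
          simp only
          ring
      _ = (Real.pi / k : ℝ) * c₀ := by
          rw [integral_add hadd hw, key, integral_mul_const, integral_complex_ofReal,
            integral_weight hk]
          push_cast
          field_simp
          ring
  · have : Tendsto (fun t : ℝ => 2 * t) atTop atTop := tendsto_id.const_mul_atTop two_pos
    simpa using (Real.tendsto_exp_neg_atTop_nhds_zero.comp this).const_mul 8
  · have : Tendsto (fun t : ℝ => Real.exp (4 * t)) atTop atTop :=
      Real.tendsto_exp_atTop.comp (tendsto_id.const_mul_atTop four_pos)
    filter_upwards [this.eventually_ge_atTop (2 * k ^ 2)] with t ht y hy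
    refine (hbound t y (Real.exp t ^ 4 / 2) hy (by positivity) ?_).trans (le_of_eq ?_)
    · rw [hexp4, le_abs]; left; linarith
    · rw [hexp4, hexp2, Real.exp_neg, show 4 * t = 2 * t + 2 * t by ring, Real.exp_add]
      field_simp
      norm_num
  · have : Tendsto (fun t : ℝ => 2 * t) atBot atBot := tendsto_id.const_mul_atBot two_pos
    simpa using (Real.tendsto_exp_atBot.comp this).const_mul (8 / k ^ 2)
  · have : Tendsto (fun t : ℝ => Real.exp (4 * t)) atBot (𝓝 0) :=
      Real.tendsto_exp_atBot.comp (tendsto_id.const_mul_atBot four_pos)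
    filter_upwards [this.eventually_le_const (show 0 < k ^ 2 / 2 by positivity)] with t ht y hy
    refine (hbound t y (k ^ 2 / 2) hy (by positivity) ?_).trans (le_of_eq ?_)
    · rw [hexp4, le_abs]; right; linarith
    · rw [hexp2]
      field_simp
      norm_num

/-! ### The periodic orbit integrals as values of the Macdonald function -/

/-- The sum of the values on the real and imaginary axes, `K₀ (z) + K₀ (i z)` for `z > 0`. -/
def macdonaldSum (c y : ℝ) : ℂ :=
  macdonald ((c * y : ℝ) : ℂ) (Real.pi / 4)
    + macdonald ((c * y : ℝ) * Complex.I) (Real.pi / 4)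

/-- Integrating Poisson's formula with respect to a parameter. -/
theorem integral_weight_mul_integral_exp {k : ℝ} (hk : 0 < k) {μ : Measure ℝ} [SFinite μ]
    {lam : ℝ → ℂ} (hre : ∀ᵐ x ∂μ, 0 ≤ (lam x).re) (him : ∀ᵐ x ∂μ, (lam x).im ≤ 0)
    (hint : Integrable (fun p : ℝ × ℝ => (weight k p.1 : ℂ) *
        (Complex.exp (-(lam p.2 * p.1)) + Complex.exp (-(lam p.2 * (p.1 * Complex.I)))))
        ((volume.restrict (Ioi 0)).prod μ)) :
    ∫ y in Ioi (0 : ℝ), (weight k y : ℂ) * ∫ x,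
        (Complex.exp (-(lam x * y)) + Complex.exp (-(lam x * (y * Complex.I)))) ∂μ
      = (Real.pi / k : ℝ) * ∫ x, Complex.exp (-(lam x * (√k * rotor))) ∂μ := by
  simp_rw [← integral_const_mul]
  rw [integral_integral_swap hint]
  refine integral_congr_ae ?_
  filter_upwards [hre, him] with x h1 h2
  exact integral_weight_mul_exp hk h1 h2

/-- Separates `x` from `t`, as a dominating function on the product space requires. It rests on `exp
t ≤ 2 (1 + sinh t)` and `1 + u ≤ exp u`. -/
theorem exp_neg_mul_sinh_le {x t : ℝ} (hx : 0 < x) (ht : 0 ≤ t) :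
    Real.exp (-(x * Real.sinh t)) ≤ (1 + 1 / x) * (2 * Real.exp (-t)) := by
  have hs : 0 ≤ Real.sinh t := Real.sinh_nonneg_iff.mpr ht
  have h1 : Real.exp t ≤ 2 * (1 + Real.sinh t) := by
    rw [Real.sinh_eq]
    have : Real.exp (-t) ≤ 1 := Real.exp_le_one_iff.2 (by linarith)
    linarith
  have h2 : 1 + x * Real.sinh t ≤ Real.exp (x * Real.sinh t) := by
    rw [add_comm]; exact Real.add_one_le_exp _
  rw [Real.exp_neg, Real.exp_neg, inv_le_iff_one_le_mul₀ (Real.exp_pos _)]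
  have h3 : 1 + Real.sinh t ≤ (1 + 1 / x) * (1 + x * Real.sinh t) := by
    have : (1 + 1 / x) * (1 + x * Real.sinh t)
      = 1 + Real.sinh t + 1 / x + x * Real.sinh t := by field_simp; ring
    rw [this]
    have : 0 ≤ 1 / x + x * Real.sinh t := by positivity
    linarith
  calc (1 : ℝ) = Real.exp t * (Real.exp t)⁻¹ := (mul_inv_cancel₀ (Real.exp_pos t).ne').symm
    _ ≤ 2 * ((1 + 1 / x) * Real.exp (x * Real.sinh t)) * (Real.exp t)⁻¹ := by
      refine mul_le_mul_of_nonneg_right ?_ (by positivity)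
      have := mul_le_mul_of_nonneg_left h2 (by positivity : 0 ≤ 1 + 1 / x)
      linarith
    _ = _ := by ring

section
variable {k c : ℝ} (hk : 0 < k) (hc : 0 < c)
include hk hc

theorem integrable_prod_weight_cos :
    Integrable (fun p : ℝ × ℝ => (weight k p.1 : ℂ) *
        (Complex.exp (-(c * Real.cos p.2 * p.1))
          + Complex.exp (-(c * Real.cos p.2 * (p.1 * Complex.I)))))
        ((volume.restrict (Ioi 0)).prod (volume.restrict (Ioc 0 (Real.pi / 4)))) := by
  have hw := continuous_weight hk
  have h : Integrable (fun p : ℝ × ℝ => weight k p.1 * (fun _ : ℝ => (2 : ℝ)) p.2)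
      ((volume.restrict (Ioi 0)).prod (volume.restrict (Ioc 0 (Real.pi / 4)))) :=
    (integrableOn_weight hk).mul_prod (integrable_const _)
  refine h.mono' (Continuous.aestronglyMeasurable (by fun_prop)) ?_
  rw [Measure.prod_restrict]
  refine (ae_restrict_mem (measurableSet_Ioi.prod measurableSet_Ioc)).mono fun p hp => ?_
  obtain ⟨hy, hθ⟩ := hp
  have hy : 0 < p.1 := hy
  have hcos : 0 ≤ Real.cos p.2 :=
    le_trans (by positivity) (sqrt_two_div_two_le_cos hθ.1.le hθ.2)
  rw [norm_mul, Complex.norm_real, Real.norm_of_nonneg (weight_nonneg hk hy.le)]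
  refine mul_le_mul_of_nonneg_left ?_ (weight_nonneg hk hy.le)
  refine (norm_add_le _ _).trans ?_
  have e1 : ‖Complex.exp (-(c * Real.cos p.2 * p.1))‖ ≤ 1 := by
    rw [Complex.norm_exp, Real.exp_le_one_iff, ← Complex.ofReal_mul, ← Complex.ofReal_mul,
      Complex.neg_re, Complex.ofReal_re, neg_nonpos]
    positivity
  have e2 : ‖Complex.exp (-(c * Real.cos p.2 * (p.1 * Complex.I)))‖ ≤ 1 := by
    rw [← mul_assoc, ← Complex.ofReal_mul, ← Complex.ofReal_mul, ← neg_mul, ← Complex.ofReal_neg,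
      Complex.norm_exp_ofReal_mul_I]
  linarith

theorem integrable_prod_weight_cosh :
    Integrable (fun p : ℝ × ℝ => (weight k p.1 : ℂ) *
        (Complex.exp (-(c * Complex.cosh (p.2 + (-(Real.pi / 4) : ℝ) * Complex.I) * p.1))
          + Complex.exp (-(c * Complex.cosh (p.2 + (-(Real.pi / 4) : ℝ) * Complex.I) *
            (p.1 * Complex.I)))))
        ((volume.restrict (Ioi 0)).prod (volume.restrict (Ioi 0))) := by
  have hw := continuous_weight hk
  have hs : 0 < √2 / 2 := by positivity
  set c' := c * (√2 / 2) with hc'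
  have hc'0 : 0 < c' := by positivity
  have h0 : IntegrableOn (fun y => 4 * (weight k y + 1 / c' * (weight k y * (1 / y)))) (Ioi 0) :=
    ((integrableOn_weight hk).add ((integrableOn_weight_div hk).const_mul (1 / c'))).const_mul 4
  have h : Integrable (fun p : ℝ × ℝ => (4 * (weight k p.1 + 1 / c' * (weight k p.1 * (1 / p.1))))
      * Real.exp (-p.2))
      ((volume.restrict (Ioi 0)).prod (volume.restrict (Ioi 0))) :=
    h0.mul_prod (integrableOn_exp_neg_Ioi 0)
  refine h.mono' (Continuous.aestronglyMeasurable (by fun_prop)) ?_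
  rw [Measure.prod_restrict]
  refine (ae_restrict_mem (measurableSet_Ioi.prod measurableSet_Ioi)).mono fun p hp => ?_
  obtain ⟨hy, ht⟩ := hp
  have hy : 0 < p.1 := hy
  have ht : 0 < p.2 := ht
  rw [norm_mul, Complex.norm_real, Real.norm_of_nonneg (weight_nonneg hk hy.le)]
  have e1 : ‖Complex.exp (-(c * Complex.cosh (p.2 + (-(Real.pi / 4) : ℝ) * Complex.I) * p.1))‖
      ≤ Real.exp (-(c' * p.1 * Real.sinh p.2)) := by
    rw [mul_right_comm]
    refine norm_exp_neg_mul_cosh_le ?_ ?_ ht.le <;>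
      rw [← Complex.ofReal_mul, Complex.ofReal_re, Real.cos_pi_div_four]
    · positivity
    · rw [Complex.ofReal_im, hc']; linarith
  have e2 : ‖Complex.exp (-(c * Complex.cosh (p.2 + (-(Real.pi / 4) : ℝ) * Complex.I) *
      (p.1 * Complex.I)))‖ ≤ Real.exp (-(c' * p.1 * Real.sinh p.2)) := by
    rw [mul_right_comm, ← mul_assoc]
    refine norm_exp_neg_mul_cosh_le ?_ ?_ ht.le <;>
      rw [← Complex.ofReal_mul]
    · simp
    · simp; rw [hc']; linarith
  have e3 := exp_neg_mul_sinh_le (x := c' * p.1) (by positivity) ht.le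
  calc _ ≤ weight k p.1 * (2 * ((1 + 1 / (c' * p.1)) * (2 * Real.exp (-p.2)))) := by
        refine mul_le_mul_of_nonneg_left ?_ (weight_nonneg hk hy.le)
        refine (norm_add_le _ _).trans ?_
        linarith
    _ = _ := by field_simp; ring

omit hk in
theorem macdonaldSum_eq {y : ℝ} (hy : 0 < y) : macdonaldSum c y =
    (∫ t in Ioi (0 : ℝ),
      (Complex.exp (-(c * Complex.cosh (t + (-(Real.pi / 4) : ℝ) * Complex.I) * y))
          + Complex.exp (-(c * Complex.cosh (t + (-(Real.pi / 4) : ℝ) * Complex.I) *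
            (y * Complex.I)))))
    - Complex.I * ∫ θ in Ioc 0 (Real.pi / 4), (Complex.exp (-(c * Real.cos θ * y))
          + Complex.exp (-(c * Real.cos θ * (y * Complex.I)))) := by
  have hs : 0 < √2 / 2 := by positivity
  have hpi : 0 ≤ Real.pi / 4 := by positivity
  have hcy : 0 < c * y := by positivity
  unfold macdonaldSum macdonald
  rw [integral_add, integral_add, intervalIntegral.integral_of_le hpi,
    intervalIntegral.integral_of_le hpi]
  · have r1 : ∀ x : ℂ, Complex.exp (-((c * y : ℝ) * x)) = Complex.exp (-(c * x * y)) :=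
      fun x => by congr 2; push_cast; ring
    have r2 : ∀ x : ℂ, Complex.exp (-((c * y : ℝ) * Complex.I * x))
        = Complex.exp (-(c * x * (y * Complex.I))) := fun x => by congr 2; push_cast; ring
    simp only [r1, r2]
    ring
  · exact (Continuous.integrableOn_Icc (by fun_prop)).mono_set Ioc_subset_Icc_self
  · exact (Continuous.integrableOn_Icc (by fun_prop)).mono_set Ioc_subset_Icc_self
  · have := integrableOn_exp_neg_mul_cosh (z := ((c * y : ℝ) : ℂ)) (α := Real.pi / 4)
      (c := c * y * (√2 / 2)) (by positivity)
      (by rw [Complex.ofReal_re, Real.cos_pi_div_four]; positivity)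
      (by rw [Complex.ofReal_re, Complex.ofReal_im, Real.cos_pi_div_four]; linarith)
    refine this.congr_fun (fun t _ => ?_) measurableSet_Ioi
    simp only
    congr 2
    push_cast; ring
  · have := integrableOn_exp_neg_mul_cosh (z := ((c * y : ℝ) * Complex.I)) (α := Real.pi / 4)
      (c := c * y * (√2 / 2)) (by positivity) (by simp) (by simp)
    refine this.congr_fun (fun t _ => ?_) measurableSet_Ioi
    simp only
    congr 2
    push_cast; ring

theorem integrableOn_weight_mul_macdonaldSum :
    IntegrableOn (fun y : ℝ => (weight k y : ℂ) * macdonaldSum c y) (Ioi 0) := by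
  have h1 := (integrable_prod_weight_cosh hk hc).integral_prod_left
  have h2 := (integrable_prod_weight_cos hk hc).integral_prod_left
  refine IntegrableOn.congr_fun (h1.sub (h2.const_mul Complex.I)) (fun y hy => ?_)
    measurableSet_Ioi
  rw [macdonaldSum_eq hc hy]
  simp only [Pi.sub_apply, integral_const_mul]
  ring

theorem integral_weight_mul_macdonaldSum :
    ∫ y in Ioi (0 : ℝ), (weight k y : ℂ) * macdonaldSum c y
      = (Real.pi / k : ℝ) * macdonald ((c * √k : ℝ) * rotor) (Real.pi / 4) := by
  have hs : 0 < √2 / 2 := by positivity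
  have hpi : 0 ≤ Real.pi / 4 := by positivity
  have h1 := (integrable_prod_weight_cosh hk hc).integral_prod_left
  have h2 := (integrable_prod_weight_cos hk hc).integral_prod_left
  have k1 := integral_weight_mul_integral_exp hk
    (lam := fun t => c * Complex.cosh (t + (-(Real.pi / 4) : ℝ) * Complex.I)) ?_ ?_
    (integrable_prod_weight_cosh hk hc)
  have k2 := integral_weight_mul_integral_exp hk (lam := fun θ => c * Real.cos θ) ?_ ?_
    (integrable_prod_weight_cos hk hc)
  · calc _ = ∫ y in Ioi (0 : ℝ), ((∫ t in Ioi (0 : ℝ), (weight k y : ℂ) *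
          (Complex.exp (-(c * Complex.cosh (t + (-(Real.pi / 4) : ℝ) * Complex.I) * y))
          + Complex.exp (-(c * Complex.cosh (t + (-(Real.pi / 4) : ℝ) * Complex.I) *
            (y * Complex.I)))))
          - Complex.I * ∫ θ in Ioc 0 (Real.pi / 4), (weight k y : ℂ) *
            (Complex.exp (-(c * Real.cos θ * y))
          + Complex.exp (-(c * Real.cos θ * (y * Complex.I))))) := by
          refine setIntegral_congr_fun measurableSet_Ioi fun y hy => ?_
          rw [macdonaldSum_eq hc hy, integral_const_mul, integral_const_mul]
          ring
      _ = _ := by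
          rw [integral_sub h1 (h2.const_mul Complex.I), integral_const_mul]
          simp_rw [integral_const_mul]
          rw [k1, k2, macdonald, intervalIntegral.integral_of_le hpi]
          have r : ∀ x : ℂ, (c : ℂ) * x * (√k * rotor) = (c * √k : ℝ) * rotor * x := fun x => by
            push_cast; ring
          simp only [r]
          ring
  · refine (ae_restrict_mem measurableSet_Ioc).mono fun θ hθ => ?_
    have := sqrt_two_div_two_le_cos hθ.1.le hθ.2
    rw [← Complex.ofReal_mul, Complex.ofReal_re]
    exact mul_nonneg hc.le (hs.le.trans this)
  · refine Eventually.of_forall fun θ => ?_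
    rw [← Complex.ofReal_mul, Complex.ofReal_im]
  · refine (ae_restrict_mem measurableSet_Ioi).mono fun t ht => ?_
    rw [re_mul_cosh]
    simp
    have := Real.cosh_pos t
    positivity
  · refine (ae_restrict_mem measurableSet_Ioi).mono fun t ht => ?_
    have h1 := re_mul_cosh (c * Complex.I) t (Real.pi / 4)
    have h2 : (c * Complex.I * Complex.cosh (t + (-(Real.pi / 4) : ℝ) * Complex.I)).re
        = -(c * Complex.cosh (t + (-(Real.pi / 4) : ℝ) * Complex.I)).im := by
      rw [mul_right_comm, Complex.mul_I_re]
    rw [← neg_nonneg, ← h2, h1]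
    simp
    have := Real.sinh_nonneg_iff.2 (le_of_lt ht : 0 ≤ t)
    positivity

end

/-- The two summands are the values of `K₀(c √w)` at `w = y²` and `w = -y²`, seen from the upper
half plane. An integral of the kernel over `p > 0` is thus a Poisson integral over the whole line.
-/
theorem re_macdonaldSum {c y : ℝ} (hc : 0 < c) (hy : 0 < y) :
    (2 / Real.pi) * besselK0 (c * y) - besselY0 (c * y)
      = (2 / Real.pi) * (macdonaldSum c y).re := by
  have hcy : 0 < c * y := by positivity
  rw [macdonaldSum, Complex.add_re, re_macdonald_I_mul hcy, macdonald_ofReal hcy,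
    Complex.ofReal_re]
  field_simp
  ring

theorem poIntegrand_sq {n : ℕ} (hn : 1 ≤ n) (k : ℝ) {y : ℝ} (hy : 0 < y) :
    2 * y * poIntegrand n k (y ^ 2) = (2 / Real.pi) *
      ((weight k y : ℂ) * macdonaldSum (4 * Real.pi * √n) y).re := by
  have hn' : (0 : ℝ) < n := by exact_mod_cast hn
  have hc : 0 < 4 * Real.pi * √n := by positivity
  have e : 4 * Real.pi * √(n * y ^ 2) = 4 * Real.pi * √n * y := by
    rw [Real.sqrt_mul hn'.le, Real.sqrt_sq hy.le]; ring
  rw [poIntegrand, e, re_macdonaldSum hc hy, Complex.re_ofReal_mul, weight]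
  ring

theorem integrableOn_poIntegrand {n : ℕ} (hn : 1 ≤ n) {k : ℝ} (hk : 0 < k) :
    IntegrableOn (poIntegrand n k) (Ioi 0) := by
  have hn' : (0 : ℝ) < n := by exact_mod_cast hn
  have hc : 0 < 4 * Real.pi * √n := by positivity
  rw [← integrableOn_Ioi_comp_rpow_iff (poIntegrand n k) two_ne_zero]
  have h := (integrableOn_weight_mul_macdonaldSum hk hc).re.const_mul (2 / Real.pi)
  refine IntegrableOn.congr_fun h (fun y hy => ?_) measurableSet_Ioi
  have := poIntegrand_sq hn k (show 0 < y from hy)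
  norm_num
  simpa using this.symm

/-- With `p = y ^ 2` this is Poisson's formula at `w = i k`, where `√w = √k * rotor`. -/
theorem mul_integral_poIntegrand {n : ℕ} (hn : 1 ≤ n) {k : ℝ} (hk : 0 < k) :
    k * ∫ p in Ioi (0 : ℝ), poIntegrand n k p
      = 2 * (macdonald ((4 * Real.pi * √n * √k : ℝ) * rotor) (Real.pi / 4)).re := by
  have hn' : (0 : ℝ) < n := by exact_mod_cast hn
  have hc : 0 < 4 * Real.pi * √n := by positivity
  rw [← integral_comp_rpow_Ioi_of_pos two_pos]
  have h := integrableOn_weight_mul_macdonaldSum hk hc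
  have e : ∫ y in Ioi (0 : ℝ), ((2 : ℝ) * y ^ ((2 : ℝ) - 1)) • poIntegrand n k (y ^ (2 : ℝ))
      = (2 / Real.pi) * ∫ y in Ioi (0 : ℝ),
        ((weight k y : ℂ) * macdonaldSum (4 * Real.pi * √n) y).re := by
    rw [← integral_const_mul]
    refine setIntegral_congr_fun measurableSet_Ioi fun y hy => ?_
    have := poIntegrand_sq hn k (show 0 < y from hy)
    norm_num
    simpa using this
  have e2 := integral_re h
  simp only [RCLike.re_eq_complex_re] at e2
  rw [e, e2, integral_weight_mul_macdonaldSum hk hc, Complex.re_ofReal_mul]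
  field_simp

/-! ### The Fourier integral of `rho''` and rotation of its ray -/

/-- `v ↦ exp (-A / v) / v` -/
def rho (A v : ℝ) : ℝ := Real.exp (-(A / v)) / v

/-- The derivative of `rho A`. -/
def rhoDeriv (A v : ℝ) : ℝ := Real.exp (-(A / v)) * (A / v ^ 3 - 1 / v ^ 2)

/-- The second derivative of `rho A`. -/
def rhoDeriv2 (A v : ℝ) : ℝ := Real.exp (-(A / v)) * (A ^ 2 / v ^ 5 - 4 * A / v ^ 4 + 2 / v ^ 3)

theorem pow_mul_exp_neg_le {a w : ℝ} (ha : 0 < a) (hw : 0 ≤ w) (n : ℕ) :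
    w ^ n * Real.exp (-(a * w)) ≤ n.factorial / a ^ n := by
  have h := Real.pow_div_factorial_le_exp (a * w) (by positivity) n
  rw [Real.exp_neg, ← div_eq_mul_inv, div_le_div_iff₀ (Real.exp_pos _) (by positivity)]
  rw [div_le_iff₀ (by positivity), mul_pow] at h
  linarith

/-- A positive integrable function on the line that tends to `0` at both ends. -/
def sechBound (t : ℝ) : ℝ := Real.exp t * (1 + Real.exp t ^ 2)⁻¹

theorem integrable_sechBound : Integrable sechBound :=
  (integrable_exp_smul_comp_exp_iff fun y : ℝ => (1 + y ^ 2)⁻¹).2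
    integrable_inv_one_add_sq.integrableOn

theorem sechBound_nonneg (t : ℝ) : 0 ≤ sechBound t := by unfold sechBound; positivity

theorem tendsto_sechBound_atTop : Tendsto sechBound atTop (𝓝 0) := by
  refine squeeze_zero sechBound_nonneg (fun t => ?_) Real.tendsto_exp_neg_atTop_nhds_zero
  unfold sechBound
  rw [Real.exp_neg, ← div_eq_mul_inv, div_le_iff₀ (by positivity)]
  have := Real.exp_pos t
  field_simp
  linarith

theorem tendsto_sechBound_atBot : Tendsto sechBound atBot (𝓝 0) := by
  refine squeeze_zero sechBound_nonneg (fun t => ?_) Real.tendsto_exp_atBot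
  unfold sechBound
  have := Real.exp_pos t
  refine mul_le_of_le_one_right this.le (inv_le_one_of_one_le₀ ?_)
  nlinarith

theorem exists_pow_mul_exp_le_sechBound {a : ℝ} (ha : 0 < a) (n : ℕ) :
    ∃ C, 0 ≤ C ∧ ∀ t : ℝ, Real.exp (-t) ^ (n + 1) * Real.exp (-(a * Real.exp (-t)))
      ≤ C * sechBound t := by
  -- With `w = exp (-t)`, `sechBound t = w / (1 + w ^ 2)`; the two summands bound `w ^ n` and `w ^
  -- (n + 2)` times the exponential.
  refine ⟨n.factorial / a ^ n + (n + 2).factorial / a ^ (n + 2), by positivity, fun t => ?_⟩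
  have h1 := pow_mul_exp_neg_le ha (Real.exp_pos (-t)).le n
  have h2 := pow_mul_exp_neg_le ha (Real.exp_pos (-t)).le (n + 2)
  have h3 : sechBound t = Real.exp (-t) / (1 + Real.exp (-t) ^ 2) := by
    unfold sechBound
    rw [Real.exp_neg]
    have := Real.exp_pos t
    field_simp
    ring
  have hw := Real.exp_pos (-t)
  rw [h3, ← mul_div_assoc, le_div_iff₀ (by positivity)]
  have := mul_le_mul_of_nonneg_right (add_le_add h1 h2) hw.le
  refine le_trans (le_of_eq ?_) this
  ring

section
variable {A B : ℝ} (hA : 0 < A) (hB : 0 < B)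

/-- `v exp (-i B v) rho'' A v` at `v = exp τ` -/
def rotated (A B : ℝ) (τ : ℂ) : ℂ :=
  Complex.exp (-(Complex.I * B * Complex.exp τ) - A * Complex.exp (-τ)) *
    (A ^ 2 * Complex.exp (-τ) ^ 4 - 4 * A * Complex.exp (-τ) ^ 3 + 2 * Complex.exp (-τ) ^ 2)

/-- This is `exp (-i B v) (rho' + i B rho)` at `v = exp τ`, which performs two integrations by parts
at once: its `v`-derivative is `exp (-i B v) (rho'' + B ^ 2 rho)`. -/
def rotatedPrimitive (A B : ℝ) (τ : ℂ) : ℂ :=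
  Complex.exp (-(Complex.I * B * Complex.exp τ) - A * Complex.exp (-τ)) *
    (A * Complex.exp (-τ) ^ 3 - Complex.exp (-τ) ^ 2 + Complex.I * B * Complex.exp (-τ))

theorem hasDerivAt_rotatedPrimitive (A B : ℝ) (τ : ℂ) :
    HasDerivAt (rotatedPrimitive A B) (rotated A B τ + B ^ 2 *
      Complex.exp (-(Complex.I * B * Complex.exp τ) - A * Complex.exp (-τ))) τ := by
  have h1 : HasDerivAt (fun τ : ℂ => Complex.exp (-τ)) (-Complex.exp (-τ)) τ := by
    simpa using (hasDerivAt_neg τ).cexp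
  have h2 := (((Complex.hasDerivAt_exp τ).const_mul (Complex.I * B)).neg.sub
    (h1.const_mul (A : ℂ))).cexp
  have h3 := (((h1.pow 3).const_mul (A : ℂ)).sub (h1.pow 2)).add (h1.const_mul (Complex.I * B))
  have h4 := h2.mul h3
  have hvw : Complex.exp τ * Complex.exp (-τ) = 1 := by rw [← Complex.exp_add]; simp
  refine h4.congr_deriv ?_
  simp only [Pi.sub_apply, Pi.add_apply, Pi.pow_apply, Pi.neg_apply, rotated]
  set v := Complex.exp τ
  set w := Complex.exp (-τ)
  set e := Complex.exp (-(Complex.I * B * v) - A * w)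
  push_cast
  linear_combination (-(e * Complex.I * B * (A * w ^ 2 - w + Complex.I * B))) * hvw
    - (e * B ^ 2) * Complex.I_sq

include hA hB

/-- In the sector `-π / 4 ≤ arg v ≤ 0` the factor `exp (-i B v)` has modulus at most `1`, while the
real part of `1 / v` is at least `(√2 / 2) / |v|`. -/
theorem norm_exp_rotated_le {t y : ℝ} (hy : y ∈ Icc (-(Real.pi / 4)) 0) :
    ‖Complex.exp (-(Complex.I * B * Complex.exp (t + y * Complex.I))
      - A * Complex.exp (-(t + y * Complex.I)))‖ ≤
      Real.exp (-(A * (√2 / 2) * Real.exp (-t))) := by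
  have h1 : √2 / 2 ≤ Real.cos y := by
    rw [← Real.cos_neg]
    exact sqrt_two_div_two_le_cos (by linarith [hy.2]) (by linarith [hy.1])
  have h2 : Real.sin y ≤ 0 :=
    Real.sin_nonpos_of_nonpos_of_neg_pi_le hy.2 (by linarith [hy.1, Real.pi_pos])
  rw [Complex.norm_exp, Real.exp_le_exp]
  have e1 : (-(Complex.I * B * Complex.exp (t + y * Complex.I))
      - A * Complex.exp (-(t + y * Complex.I))).re
      = B * Real.exp t * Real.sin y - A * Real.exp (-t) * Real.cos y := by
    rw [mul_assoc, Complex.sub_re, Complex.neg_re, Complex.I_mul_re,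
      Complex.im_ofReal_mul, Complex.re_ofReal_mul, Complex.exp_im,
      Complex.exp_re]
    simp
    ring
  rw [e1]
  have := Real.exp_pos t
  have := Real.exp_pos (-t)
  have h3 : B * Real.exp t * Real.sin y ≤ 0 := mul_nonpos_of_nonneg_of_nonpos (by positivity) h2
  have h4 := mul_le_mul_of_nonneg_left h1 (by positivity : 0 ≤ A * Real.exp (-t))
  linarith

theorem exists_norm_rotated_le : ∃ C, ∀ t : ℝ, ∀ y ∈ Icc (-(Real.pi / 4)) 0,
    ‖rotated A B (t + y * Complex.I)‖ ≤ C * sechBound t := by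
  have ha : 0 < A * (√2 / 2) := by positivity
  obtain ⟨C1, -, h1⟩ := exists_pow_mul_exp_le_sechBound ha 1
  obtain ⟨C2, -, h2⟩ := exists_pow_mul_exp_le_sechBound ha 2
  obtain ⟨C3, -, h3⟩ := exists_pow_mul_exp_le_sechBound ha 3
  refine ⟨A ^ 2 * C3 + 4 * A * C2 + 2 * C1, fun t y hy => ?_⟩
  have hn : ‖Complex.exp (-(t + y * Complex.I))‖ = Real.exp (-t) := by simp [Complex.norm_exp]
  rw [rotated, norm_mul]
  calc _ ≤ Real.exp (-(A * (√2 / 2) * Real.exp (-t))) *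
        (A ^ 2 * Real.exp (-t) ^ 4 + 4 * A * Real.exp (-t) ^ 3 + 2 * Real.exp (-t) ^ 2) := by
        refine mul_le_mul (norm_exp_rotated_le hA hB hy) ?_ (norm_nonneg _) (Real.exp_pos _).le
        generalize Complex.exp (-(t + y * Complex.I)) = w at hn
        refine (norm_add_le _ _).trans (add_le_add ((norm_sub_le _ _).trans (le_of_eq ?_))
          (le_of_eq ?_))
        · simp [hn, abs_of_pos hA]
        · simp [hn]
    _ ≤ _ := by
        have k1 := mul_le_mul_of_nonneg_left (h3 t) (by positivity : 0 ≤ A ^ 2)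
        have k2 := mul_le_mul_of_nonneg_left (h2 t) (by positivity : 0 ≤ 4 * A)
        have k3 := h1 t
        norm_num at k1 k2 k3
        linarith

theorem exists_norm_rotatedPrimitive_le : ∃ C, ∀ t : ℝ, ∀ y ∈ Icc (-(Real.pi / 4)) 0,
    ‖rotatedPrimitive A B (t + y * Complex.I)‖ ≤ C * sechBound t := by
  have ha : 0 < A * (√2 / 2) := by positivity
  obtain ⟨C1, -, h1⟩ := exists_pow_mul_exp_le_sechBound ha 0
  obtain ⟨C2, -, h2⟩ := exists_pow_mul_exp_le_sechBound ha 1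
  obtain ⟨C3, -, h3⟩ := exists_pow_mul_exp_le_sechBound ha 2
  refine ⟨A * C3 + C2 + B * C1, fun t y hy => ?_⟩
  have hn : ‖Complex.exp (-(t + y * Complex.I))‖ = Real.exp (-t) := by simp [Complex.norm_exp]
  rw [rotatedPrimitive, norm_mul]
  calc _ ≤ Real.exp (-(A * (√2 / 2) * Real.exp (-t))) *
        (A * Real.exp (-t) ^ 3 + Real.exp (-t) ^ 2 + B * Real.exp (-t)) := by
        refine mul_le_mul (norm_exp_rotated_le hA hB hy) ?_ (norm_nonneg _) (Real.exp_pos _).le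
        generalize Complex.exp (-(t + y * Complex.I)) = w at hn
        refine (norm_add_le _ _).trans (add_le_add ((norm_sub_le _ _).trans (le_of_eq ?_))
          (le_of_eq ?_))
        · simp [hn, abs_of_pos hA]
        · simp [hn, abs_of_pos hB]
    _ ≤ _ := by
        have k1 := mul_le_mul_of_nonneg_left (h3 t) hA.le
        have k2 := h2 t
        have k3 := mul_le_mul_of_nonneg_left (h1 t) hB.le
        norm_num at k1 k2 k3
        linarith

theorem integrable_rotated {y : ℝ} (hy : y ∈ Icc (-(Real.pi / 4)) 0) :
    Integrable fun t : ℝ => rotated A B (t + y * Complex.I) := by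
  obtain ⟨C, hC⟩ := exists_norm_rotated_le hA hB
  refine (integrable_sechBound.const_mul C).mono' ?_ (Eventually.of_forall fun t => hC t y hy)
  unfold rotated
  exact Continuous.aestronglyMeasurable (by fun_prop)

omit hA hB in
theorem exp_rotated_eq (t : ℝ) :
    Complex.exp (-(Complex.I * B * Complex.exp (t + (-(Real.pi / 4) : ℝ) * Complex.I))
      - A * Complex.exp (-(t + (-(Real.pi / 4) : ℝ) * Complex.I)))
      = Complex.exp (-(rotor * ((B * Real.exp t + A * Real.exp (-t) : ℝ) : ℂ))) := by
  have h1 : Complex.exp ((Real.pi / 4 : ℝ) * Complex.I) = rotor := by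
    rw [Complex.exp_mul_I, ← Complex.ofReal_cos, ← Complex.ofReal_sin, Real.cos_pi_div_four,
      Real.sin_pi_div_four]
    apply Complex.ext <;> simp [rotor]
  have h2 : Complex.exp ((-(Real.pi / 4) : ℝ) * Complex.I) = rotor⁻¹ := by
    rw [← h1, ← Complex.exp_neg]; congr 1; push_cast; ring
  have h0 : rotor ≠ 0 := by rw [← h1]; exact Complex.exp_ne_zero _
  have h3 : Complex.I * rotor⁻¹ = rotor := by
    rw [← rotor_sq]; field_simp
  have h4 : Complex.exp (t + (-(Real.pi / 4) : ℝ) * Complex.I) = Complex.exp t * rotor⁻¹ := by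
    rw [Complex.exp_add, h2]
  have h5 : Complex.exp (-(t + (-(Real.pi / 4) : ℝ) * Complex.I)) = Complex.exp (-t) * rotor := by
    rw [← h1, ← Complex.exp_add]; congr 1; push_cast; ring
  rw [h4, h5]
  congr 1
  push_cast
  linear_combination (-(B * Complex.exp t)) * h3

theorem integrable_exp_rotated : Integrable fun t : ℝ =>
    Complex.exp (-(rotor * ((B * Real.exp t + A * Real.exp (-t) : ℝ) : ℂ))) := by
  have hs : 0 < √2 / 2 := by positivity
  obtain ⟨C, -, hC⟩ := exists_pow_mul_exp_le_sechBound (a := A * (√2 / 2)) (by positivity) 0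
  refine (integrable_sechBound.const_mul (1 / (B * (√2 / 2)) * C)).mono'
    (Continuous.aestronglyMeasurable (by fun_prop)) (Eventually.of_forall fun t => ?_)
  have h1 := hC t
  have ht := Real.exp_pos t
  have h2 := pow_mul_exp_neg_le (a := B * (√2 / 2)) (by positivity) ht.le 1
  rw [Complex.norm_exp, Complex.neg_re, Complex.re_mul_ofReal]
  have e : Real.exp (-(rotor.re * (B * Real.exp t + A * Real.exp (-t))))
      = (Real.exp t ^ 1 * Real.exp (-(B * (√2 / 2) * Real.exp t))) *
        (Real.exp (-t) ^ (0 + 1) * Real.exp (-(A * (√2 / 2) * Real.exp (-t)))) := by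
    rw [← Real.exp_nat_mul, ← Real.exp_nat_mul, ← Real.exp_add, ← Real.exp_add, ← Real.exp_add]
    congr 1
    simp only [rotor]
    push_cast
    ring
  rw [e, mul_assoc (1 / _) C]
  refine mul_le_mul ?_ h1 (by positivity) (by positivity)
  simpa using h2

/-- The parts are integrated on the rotated ray, because on the real one `exp (-i B v) rho v` decays
only like `1 / v` and is not absolutely integrable. -/
theorem integral_rotated_neg_pi_div_four :
    ∫ t : ℝ, rotated A B (t + (-(Real.pi / 4) : ℝ) * Complex.I)
      = -B ^ 2 * ∫ t : ℝ,
        Complex.exp (-(rotor * ((B * Real.exp t + A * Real.exp (-t) : ℝ) : ℂ))) := by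
  have hpi : 0 ≤ Real.pi / 4 := by positivity
  have hy : -(Real.pi / 4) ∈ Icc (-(Real.pi / 4)) 0 := left_mem_Icc.2 (by linarith)
  obtain ⟨C, hC⟩ := exists_norm_rotatedPrimitive_le hA hB
  have hi1 := integrable_rotated hA hB hy
  have hi2 := (integrable_exp_rotated hA hB).const_mul ((B : ℂ) ^ 2)
  have key := integral_of_hasDerivAt_of_tendsto (m := (0 : ℂ)) (n := (0 : ℂ))
    (f := fun t : ℝ => rotatedPrimitive A B (t + (-(Real.pi / 4) : ℝ) * Complex.I))
    (f' := fun t : ℝ => rotated A B (t + (-(Real.pi / 4) : ℝ) * Complex.I) + B ^ 2 *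
      Complex.exp (-(rotor * ((B * Real.exp t + A * Real.exp (-t) : ℝ) : ℂ)))) ?_ (hi1.add hi2) ?_ ?_
  · rw [integral_add hi1 hi2, integral_const_mul] at key
    linear_combination key
  · intro t
    have h := hasDerivAt_rotatedPrimitive A B (t + (-(Real.pi / 4) : ℝ) * Complex.I)
    rw [exp_rotated_eq] at h
    exact (h.comp_add_const (t : ℂ) _).comp_ofReal
  · rw [tendsto_zero_iff_norm_tendsto_zero]
    exact squeeze_zero (fun _ => norm_nonneg _) (fun t => hC t _ hy)
      (by simpa using tendsto_sechBound_atBot.const_mul C)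
  · rw [tendsto_zero_iff_norm_tendsto_zero]
    exact squeeze_zero (fun _ => norm_nonneg _) (fun t => hC t _ hy)
      (by simpa using tendsto_sechBound_atTop.const_mul C)

omit hA hB in
theorem rotated_ofReal (t : ℝ) : rotated A B (t + (0 : ℝ) * Complex.I) = Real.exp t •
    (Complex.exp (-(Complex.I * B * Real.exp t)) * (rhoDeriv2 A (Real.exp t) : ℂ)) := by
  have h : Complex.exp (-t) = (Complex.exp t)⁻¹ := Complex.exp_neg _
  rw [rotated, rhoDeriv2, Complex.ofReal_zero, zero_mul, add_zero, sub_eq_add_neg, Complex.exp_add,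
    Complex.real_smul, h]
  push_cast
  have := Complex.exp_ne_zero t
  rw [div_eq_mul_inv]
  field_simp

theorem integrableOn_exp_mul_rhoDeriv2 : IntegrableOn (fun v : ℝ =>
    Complex.exp (-(Complex.I * B * v)) * (rhoDeriv2 A v : ℂ)) (Ioi 0) := by
  have h := integrable_rotated hA hB (y := 0) (right_mem_Icc.2 (by linarith [Real.pi_pos]))
  simp only [rotated_ofReal] at h
  exact (integrable_exp_smul_comp_exp_iff fun v : ℝ =>
    Complex.exp (-(Complex.I * B * v)) * (rhoDeriv2 A v : ℂ)).1 h

theorem integral_exp_mul_rhoDeriv2 :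
    ∫ v in Ioi (0 : ℝ), Complex.exp (-(Complex.I * B * v)) * (rhoDeriv2 A v : ℂ)
      = -B ^ 2 * ∫ t : ℝ,
        Complex.exp (-(rotor * ((B * Real.exp t + A * Real.exp (-t) : ℝ) : ℂ))) := by
  have hpi : 0 ≤ Real.pi / 4 := by positivity
  obtain ⟨C, hC⟩ := exists_norm_rotated_le hA hB
  rw [← integral_rotated_neg_pi_div_four hA hB,
    integral_eq_integral_of_differentiableOn_strip (F := rotated A B)
      (neg_nonpos.2 hpi) ?_ (integrable_rotated hA hB (left_mem_Icc.2 (by linarith)))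
      (integrable_rotated hA hB (right_mem_Icc.2 (by linarith)))
      (by simpa using tendsto_sechBound_atTop.const_mul C) (Eventually.of_forall hC)
      (by simpa using tendsto_sechBound_atBot.const_mul C) (Eventually.of_forall hC)]
  · simp only [rotated_ofReal]
    rw [integral_exp_smul_comp_exp (fun v : ℝ =>
      Complex.exp (-(Complex.I * B * v)) * (rhoDeriv2 A v : ℂ))]
  · unfold rotated
    exact Differentiable.differentiableOn (by fun_prop)

/-- Translation by `log √(B / A)` balances the two exponentials into a hyperbolic cosine, whose
evenness gives the factor `2`. -/
theorem two_mul_macdonald_rotor_mul :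
    2 * macdonald ((2 * √(A * B) : ℝ) * rotor) (Real.pi / 4)
      = ∫ t : ℝ, Complex.exp (-(rotor * ((B * Real.exp t + A * Real.exp (-t) : ℝ) : ℂ))) := by
  rw [macdonald_rotor_mul (by positivity)]
  have hsA := Real.sqrt_pos.2 hA
  have hsB := Real.sqrt_pos.2 hB
  have e : ∀ t : ℝ, 2 * √(A * B) * Real.cosh (t + Real.log √(B / A))
      = B * Real.exp t + A * Real.exp (-t) := by
    intro t
    rw [Real.cosh_eq, neg_add, Real.exp_add, Real.exp_add, Real.exp_neg (Real.log _),
      Real.exp_log (Real.sqrt_pos.2 (by positivity)), Real.sqrt_mul hA.le, Real.sqrt_div hB.le]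
    have e1 : B = √B * √B := (Real.mul_self_sqrt hB.le).symm
    have e2 : A = √A * √A := (Real.mul_self_sqrt hA.le).symm
    generalize Real.exp t = x
    generalize Real.exp (-t) = y
    rw [inv_div]
    have : √A * √B * (x * (√B / √A) + y * (√A / √B)) = √B * √B * x + √A * √A * y := by
      field_simp
    rw [← e1, ← e2] at this
    linarith
  set f : ℝ → ℂ := fun t => Complex.exp (-((2 * √(A * B) : ℝ) * rotor * Real.cosh t)) with hf
  have e' : ∀ t : ℝ, f (t + Real.log √(B / A))
      = Complex.exp (-(rotor * ((B * Real.exp t + A * Real.exp (-t) : ℝ) : ℂ))) := by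
    intro t
    rw [← e]
    change Complex.exp _ = _
    congr 1
    rw [Complex.ofReal_mul (2 * √(A * B))]
    ring
  have hfi : Integrable f := by
    have h := integrable_exp_rotated hA hB
    simp only [← e'] at h
    simpa using h.comp_sub_right (Real.log √(B / A))
  have h2 : ∫ t in Iic (0 : ℝ), f t = ∫ t in Ioi (0 : ℝ), f t := by
    rw [← neg_zero, ← integral_comp_neg_Ioi]
    simp [hf]
  rw [← integral_congr_ae (Eventually.of_forall e'), integral_add_right_eq_self f,
    ← intervalIntegral.integral_Iic_add_Ioi hfi.integrableOn hfi.integrableOn, h2, two_mul]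

end

/-- The double series over `a, b ≥ 1` whose sum is `k T^po(k) / (2 π)`. -/
def dualTerm (k : ℝ) (a b : ℕ) : ℝ :=
  -(1 / (2 * Real.pi * b) ^ 2) *
    ∫ v in Ioi (0 : ℝ), Real.cos (2 * Real.pi * b * v) * rhoDeriv2 (2 * Real.pi * a * k) v

/-- The value depends only on `A * B`. The asymmetric choice puts `b` into a frequency and `a k`
into `rho`, so that the sum over `b` is a Fourier series and the sum over `a` a geometric one. -/
theorem mul_integral_poIntegrand_eq_dualTerm {k : ℝ} (hk : 0 < k) {a b : ℕ} (ha : 1 ≤ a)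
    (hb : 1 ≤ b) :
    k * ∫ p in Ioi (0 : ℝ), poIntegrand (a * b) k p = dualTerm k a b := by
  have ha' : (0 : ℝ) < a := by exact_mod_cast ha
  have hb' : (0 : ℝ) < b := by exact_mod_cast hb
  set A := 2 * Real.pi * a * k with hA
  set B := 2 * Real.pi * b with hB
  have hA0 : 0 < A := by positivity
  have hB0 : 0 < B := by positivity
  have e : 4 * Real.pi * √(a * b : ℕ) * √k = 2 * √(A * B) := by
    have : A * B = (2 * Real.pi) ^ 2 * ((a * b : ℕ) * k) := by rw [hA, hB]; push_cast; ring
    rw [this, Real.sqrt_mul (by positivity), Real.sqrt_sq (by positivity),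
      Real.sqrt_mul (by positivity)]
    ring
  have h1 := integral_exp_mul_rhoDeriv2 hA0 hB0
  rw [← two_mul_macdonald_rotor_mul hA0 hB0] at h1
  have h2 := integral_re (integrableOn_exp_mul_rhoDeriv2 hA0 hB0)
  simp only [RCLike.re_eq_complex_re] at h2
  have h3 : ∀ v : ℝ, (Complex.exp (-(Complex.I * B * v)) * (rhoDeriv2 A v : ℂ)).re
      = Real.cos (B * v) * rhoDeriv2 A v := by
    intro v
    rw [Complex.re_mul_ofReal, show -(Complex.I * B * v) = ((-(B * v) : ℝ) : ℂ) * Complex.I by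
      push_cast; ring, Complex.exp_ofReal_mul_I_re, Real.cos_neg]
  simp only [h3] at h2
  rw [mul_integral_poIntegrand (Nat.mul_pos ha hb) hk, e, dualTerm, ← hB, h2, h1,
    ← Complex.ofReal_pow, ← Complex.ofReal_neg, Complex.re_ofReal_mul]
  simp
  field_simp

/-! ### Euler-Maclaurin summation with the periodic Bernoulli polynomial -/

/-- The periodic second Bernoulli polynomial. -/
def periodicBernoulli (v : ℝ) : ℝ := Int.fract v ^ 2 - Int.fract v + 1 / 6

theorem abs_periodicBernoulli_le (v : ℝ) : |periodicBernoulli v| ≤ 1 := by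
  have h0 := Int.fract_nonneg v
  have h1 := (Int.fract_lt_one v).le
  unfold periodicBernoulli
  rw [abs_le]
  constructor <;> nlinarith

theorem measurable_periodicBernoulli : Measurable periodicBernoulli := by
  unfold periodicBernoulli
  fun_prop

theorem periodicBernoulli_of_mem_Icc {m : ℕ} {v : ℝ} (hv : v ∈ Icc (m : ℝ) (m + 1)) :
    periodicBernoulli v = (v - m) ^ 2 - (v - m) + 1 / 6 := by
  unfold periodicBernoulli
  rcases eq_or_lt_of_le hv.2 with h | h
  -- The fractional part jumps at the right endpoint, but the polynomial takes equal values at `0`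
  -- and `1`.
  · have : Int.fract v = 0 := by rw [h]; exact_mod_cast Int.fract_natCast (m + 1)
    rw [this, h]; ring
  · have : Int.fract v = v - m := by
      rw [Int.fract_eq_iff]
      exact ⟨by linarith [hv.1], by linarith, m, by push_cast; ring⟩
    rw [this]

theorem hasSum_cos_div_sq (v : ℝ) : HasSum (fun b : ℕ =>
    1 / (2 * Real.pi * (b + 1 : ℕ)) ^ 2 * Real.cos (2 * Real.pi * (b + 1 : ℕ) * v))
    (periodicBernoulli v / 4) := by
  have h := hasSum_one_div_nat_pow_mul_cos one_ne_zero
    ⟨Int.fract_nonneg v, (Int.fract_lt_one v).le⟩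
  -- The term of index `0` is zero, being divided by `0`, so removing it does not change the sum.
  have h2 := (hasSum_nat_add_iff' 1).2 (h.mul_left (1 / (2 * Real.pi) ^ 2))
  have hpi := Real.pi_ne_zero
  convert! h2 using 1
  · ext b
    have : Real.cos (2 * Real.pi * (b + 1 : ℕ) * Int.fract v)
        = Real.cos (2 * Real.pi * (b + 1 : ℕ) * v) := by
      rw [← Real.cos_sub_int_mul_two_pi (2 * Real.pi * (b + 1 : ℕ) * v) ((b + 1 : ℕ) * ⌊v⌋)]
      congr 1
      rw [← Int.self_sub_floor]
      push_cast
      ring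
    rw [this]
    field_simp
    ring
  · have hB : (Polynomial.map (algebraMap ℚ ℝ) (Polynomial.bernoulli (2 * 1))).eval (Int.fract v)
        = periodicBernoulli v := by
      simp only [Polynomial.bernoulli, Finset.sum_range_succ, Finset.sum_range_zero, mul_one,
        Polynomial.map_add, Polynomial.map_monomial, Polynomial.eval_add, Polynomial.eval_monomial,
        zero_add, bernoulli_zero, bernoulli_one, bernoulli_two, periodicBernoulli]
      norm_num
      ring
    rw [hB]
    simp
    field_simp
    ring

/-- The value that division by zero assigns agrees, for `A > 0`, with the limit from the right.
Hence `rho` is continuous on the closed half line. -/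
theorem rho_zero (A : ℝ) : rho A 0 = 0 := by simp [rho]

theorem rhoDeriv_zero (A : ℝ) : rhoDeriv A 0 = 0 := by simp [rhoDeriv]

theorem hasDerivAt_rho (A : ℝ) {v : ℝ} (hv : v ≠ 0) : HasDerivAt (rho A) (rhoDeriv A v) v := by
  have h1 : HasDerivAt (fun v : ℝ => -(A / v)) (A / v ^ 2) v := by
    refine ((hasDerivAt_inv hv).const_mul (-A)).congr_deriv ?_ |>.congr_of_eventuallyEq
      (Eventually.of_forall fun x => ?_)
    · field_simp
    · simp only; rw [div_eq_mul_inv]; ring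
  refine (h1.exp.div (hasDerivAt_id v) hv).congr_deriv ?_
  unfold rhoDeriv
  simp only [id]
  field_simp

theorem hasDerivAt_rhoDeriv (A : ℝ) {v : ℝ} (hv : v ≠ 0) :
    HasDerivAt (rhoDeriv A) (rhoDeriv2 A v) v := by
  have h1 : HasDerivAt (fun v : ℝ => -(A / v)) (A / v ^ 2) v := by
    refine ((hasDerivAt_inv hv).const_mul (-A)).congr_deriv ?_ |>.congr_of_eventuallyEq
      (Eventually.of_forall fun x => ?_)
    · field_simp
    · simp only; rw [div_eq_mul_inv]; ring
  have h2 := ((hasDerivAt_const v A).div (hasDerivAt_pow 3 v) (pow_ne_zero 3 hv)).sub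
    ((hasDerivAt_const v (1 : ℝ)).div (hasDerivAt_pow 2 v) (pow_ne_zero 2 hv))
  refine (h1.exp.mul h2).congr_deriv ?_
  unfold rhoDeriv2
  simp only [Pi.sub_apply, Pi.div_apply]
  field_simp
  ring

section
variable {A : ℝ} (hA : 0 < A)
include hA

theorem exp_div_pow_le (n : ℕ) {v : ℝ} (hv : 0 ≤ v) :
    Real.exp (-(A / v)) * (1 / v ^ (n + 1)) ≤ (n + 2).factorial / A ^ (n + 2) * v := by
  rcases hv.eq_or_lt with rfl | hv
  · simp
  have h := pow_mul_exp_neg_le hA (inv_nonneg.2 hv.le) (n + 2)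
  rw [← div_eq_mul_inv] at h
  have h2 := mul_le_mul_of_nonneg_right h hv.le
  refine le_trans (le_of_eq ?_) h2
  rw [inv_pow]
  field_simp
  ring

theorem continuousOn_rho : ContinuousOn (rho A) (Ici 0) := by
  intro v hv
  rcases (show (0 : ℝ) ≤ v from hv).eq_or_lt with rfl | hv
  · rw [ContinuousWithinAt, rho_zero]
    have h : Tendsto (fun v : ℝ => (2 : ℕ).factorial / A ^ 2 * v) (𝓝[Ici 0] 0) (𝓝 0) :=
      ((by fun_prop : Continuous fun v : ℝ => (2 : ℕ).factorial / A ^ 2 * v).tendsto'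
        0 0 (by simp)).mono_left nhdsWithin_le_nhds
    refine tendsto_of_tendsto_of_tendsto_of_le_of_le' tendsto_const_nhds h ?_ ?_
    · filter_upwards [self_mem_nhdsWithin] with x hx
      have hx : 0 ≤ x := hx
      unfold rho; positivity
    · filter_upwards [self_mem_nhdsWithin] with x hx
      have := exp_div_pow_le hA 0 (show 0 ≤ x from hx)
      simpa [rho, div_eq_mul_inv] using this
  · exact (hasDerivAt_rho A hv.ne').continuousAt.continuousWithinAt

theorem continuousOn_rhoDeriv : ContinuousOn (rhoDeriv A) (Ici 0) := by
  intro v hv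
  rcases (show (0 : ℝ) ≤ v from hv).eq_or_lt with rfl | hv
  · rw [ContinuousWithinAt, rhoDeriv_zero]
    set C : ℝ := A * (24 / A ^ 4) + 6 / A ^ 3 with hC
    have h : Tendsto (fun v : ℝ => C * v) (𝓝[Ici 0] 0) (𝓝 0) :=
      ((by fun_prop : Continuous fun v : ℝ => C * v).tendsto'
        0 0 (by simp)).mono_left nhdsWithin_le_nhds
    refine squeeze_zero_norm' ?_ h
    filter_upwards [self_mem_nhdsWithin] with x hx
    have hx : 0 ≤ x := hx
    have h1 := exp_div_pow_le hA 1 hx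
    have h2 := mul_le_mul_of_nonneg_left (exp_div_pow_le hA 2 hx) hA.le
    have e1 : 0 ≤ Real.exp (-(A / x)) * (1 / x ^ 2) := by positivity
    have e2 : 0 ≤ A * (Real.exp (-(A / x)) * (1 / x ^ 3)) := by positivity
    have e : rhoDeriv A x = A * (Real.exp (-(A / x)) * (1 / x ^ 3))
        - Real.exp (-(A / x)) * (1 / x ^ 2) := by unfold rhoDeriv; ring
    rw [e, Real.norm_eq_abs, abs_le]
    norm_num at h1 h2 e1 e2 ⊢
    rw [hC, add_mul]
    constructor <;> linarith [e1, e2, h1, h2]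
  · exact (hasDerivAt_rhoDeriv A hv.ne').continuousAt.continuousWithinAt

omit hA in
theorem tendsto_rhoDeriv_atTop (A : ℝ) : Tendsto (rhoDeriv A) atTop (𝓝 0) := by
  have h0 : Tendsto (fun v : ℝ => A / v) atTop (𝓝 0) := tendsto_const_nhds.div_atTop tendsto_id
  have h1 : Tendsto (fun v : ℝ => Real.exp (-(A / v))) atTop (𝓝 1) := by
    have := (Real.continuous_exp.tendsto _).comp h0.neg
    rw [neg_zero, Real.exp_zero] at this
    exact this
  have h2 : Tendsto (fun v : ℝ => A / v ^ 3 - 1 / v ^ 2) atTop (𝓝 0) := by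
    have a := tendsto_const_nhds (x := A) |>.div_atTop
      (tendsto_pow_atTop (α := ℝ) (three_ne_zero))
    have b := tendsto_const_nhds (x := (1 : ℝ)) |>.div_atTop
      (tendsto_pow_atTop (α := ℝ) (two_ne_zero))
    simpa using a.sub b
  have h3 := h1.mul h2
  rw [mul_zero] at h3
  exact h3

/-- Inherited from the Fourier integral at `B = 1`, whose oscillating factor has modulus `1`. -/
theorem integrableOn_rhoDeriv2 : IntegrableOn (rhoDeriv2 A) (Ioi 0) := by
  have h := (integrableOn_exp_mul_rhoDeriv2 hA one_pos).norm
  have hm : AEStronglyMeasurable (rhoDeriv2 A) (volume.restrict (Ioi 0)) := by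
    unfold rhoDeriv2
    exact Measurable.aestronglyMeasurable (by fun_prop)
  rw [IntegrableOn, ← integrable_norm_iff hm]
  refine h.congr (Eventually.of_forall fun v => ?_)
  simp only [norm_mul]
  rw [show -(Complex.I * (1 : ℝ) * v) = ((-v : ℝ) : ℂ) * Complex.I by push_cast; ring,
    Complex.norm_exp_ofReal_mul_I, one_mul, Complex.norm_real]

/-- The scaling `v ↦ A v` produces the factor `A⁻²` behind all summability over `a` and the decay of
`k T^po(k)`. -/
theorem integral_norm_rhoDeriv2 : ∫ v in Ioi (0 : ℝ), ‖rhoDeriv2 A v‖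
    = 1 / A ^ 2 * ∫ v in Ioi (0 : ℝ), ‖rhoDeriv2 1 v‖ := by
  have h := integral_comp_mul_left_Ioi (fun v => ‖rhoDeriv2 1 v‖) 0 (inv_pos.2 hA)
  rw [mul_zero, inv_inv, smul_eq_mul] at h
  have e : ∀ v ∈ Ioi (0 : ℝ), ‖rhoDeriv2 A v‖ = 1 / A ^ 3 * ‖rhoDeriv2 1 (A⁻¹ * v)‖ := by
    intro v hv
    have hv : 0 < v := hv
    rw [← Real.norm_of_nonneg (by positivity : 0 ≤ 1 / A ^ 3), ← norm_mul]
    congr 1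
    unfold rhoDeriv2
    rw [show 1 / (A⁻¹ * v) = A / v by field_simp]
    field_simp
  rw [setIntegral_congr_fun measurableSet_Ioi e, integral_const_mul, h]
  field_simp

/-- The Euler-Maclaurin remainder
`∑_{m ≤ M} rho A m - rho A M / 2 - ∫_0^M rho A`. -/
def eulerMaclaurin (A : ℝ) (M : ℕ) : ℝ :=
  ∑ m ∈ Finset.range M, rho A (m + 1 : ℕ) - 1 / 2 * rho A M - ∫ v in (0 : ℝ)..M, rho A v

theorem intervalIntegrable_rho {a b : ℝ} (ha : 0 ≤ a) (hab : a ≤ b) :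
    IntervalIntegrable (rho A) volume a b := by
  refine ContinuousOn.intervalIntegrable ((continuousOn_rho hA).mono ?_)
  rw [uIcc_of_le hab]
  exact fun x hx => ha.trans hx.1

theorem intervalIntegrable_rhoDeriv2 {a b : ℝ} (ha : 0 ≤ a) (hab : a ≤ b) :
    IntervalIntegrable (rhoDeriv2 A) volume a b := by
  rw [intervalIntegrable_iff_integrableOn_Ioc_of_le hab]
  exact (integrableOn_rhoDeriv2 hA).mono_set fun x hx => ha.trans_lt hx.1

theorem integrableOn_periodicBernoulli_mul_rhoDeriv2 :
    IntegrableOn (fun v => periodicBernoulli v * rhoDeriv2 A v) (Ioi 0) :=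
  (integrableOn_rhoDeriv2 hA).bdd_mul (c := 1)
    measurable_periodicBernoulli.aestronglyMeasurable
    (Eventually.of_forall fun v => abs_periodicBernoulli_le v)

theorem intervalIntegrable_periodicBernoulli_mul_rhoDeriv2 {a b : ℝ} (ha : 0 ≤ a) (hab : a ≤ b) :
    IntervalIntegrable (fun v => periodicBernoulli v * rhoDeriv2 A v) volume a b := by
  rw [intervalIntegrable_iff_integrableOn_Ioc_of_le hab]
  exact (integrableOn_periodicBernoulli_mul_rhoDeriv2 hA).mono_set fun x hx => ha.trans_lt hx.1

theorem integral_periodicBernoulli_mul_rhoDeriv2_Icc (m : ℕ) :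
    ∫ v in (m : ℝ)..(m + 1 : ℕ), periodicBernoulli v * rhoDeriv2 A v
      = 1 / 6 * (rhoDeriv A (m + 1 : ℕ) - rhoDeriv A m) - (rho A (m + 1 : ℕ) + rho A m)
        + 2 * ∫ v in (m : ℝ)..(m + 1 : ℕ), rho A v := by
  have hm : (0 : ℝ) ≤ m := by positivity
  have hle : (m : ℝ) ≤ (m + 1 : ℕ) := by push_cast; linarith
  have hsub : Icc (m : ℝ) (m + 1 : ℕ) ⊆ Ici 0 := fun x hx => hm.trans hx.1
  have hi := intervalIntegrable_periodicBernoulli_mul_rhoDeriv2 hA hm hle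
  have hi2 := (intervalIntegrable_rho hA hm hle).const_mul 2
  have hc : ∀ v ∈ uIcc (m : ℝ) (m + 1 : ℕ), periodicBernoulli v * rhoDeriv2 A v - 2 * rho A v
      = ((v - m) ^ 2 - (v - m) + 1 / 6) * rhoDeriv2 A v - 2 * rho A v := by
    intro v hv
    rw [uIcc_of_le hle] at hv
    rw [periodicBernoulli_of_mem_Icc (m := m) (by simpa using hv)]
  have hint : IntervalIntegrable (fun v => ((v - m) ^ 2 - (v - m) + 1 / 6) * rhoDeriv2 A v
      - 2 * rho A v) volume m (m + 1 : ℕ) :=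
    (hi.sub hi2).congr fun v hv => hc v (uIoc_subset_uIcc hv)
  -- With `P` the polynomial on this interval, the primitive is `P rho' - P' rho`; here `P'' = 2`,
  -- `P = 1 / 6` at both ends, and `P' = ∓1` there.
  have key := intervalIntegral.integral_eq_sub_of_hasDerivAt_of_le hle
    (f := fun v => ((v - m) ^ 2 - (v - m) + 1 / 6) * rhoDeriv A v - (2 * (v - m) - 1) * rho A v)
    (f' := fun v => ((v - m) ^ 2 - (v - m) + 1 / 6) * rhoDeriv2 A v - 2 * rho A v) ?_ ?_ hint
  · rw [← intervalIntegral.integral_congr hc, intervalIntegral.integral_sub hi hi2,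
      intervalIntegral.integral_const_mul] at key
    push_cast at key ⊢
    linear_combination key
  · have h1 := (continuousOn_rho hA).mono hsub
    have h2 := (continuousOn_rhoDeriv hA).mono hsub
    exact (ContinuousOn.mul (by fun_prop) h2).sub (ContinuousOn.mul (by fun_prop) h1)
  · intro v hv
    have hv0 : v ≠ 0 := (hm.trans_lt hv.1).ne'
    have h1 := hasDerivAt_rho A hv0
    have h2 := hasDerivAt_rhoDeriv A hv0
    have h3 : HasDerivAt (fun v : ℝ => v - m) 1 v := (hasDerivAt_id v).sub_const _
    have h4 := (((h3.pow 2).sub h3).add_const (1 / 6)).mul h2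
    have h5 := ((h3.const_mul 2).sub_const 1).mul h1
    refine (h4.sub h5).congr_deriv ?_
    simp
    ring

/-- No boundary terms arise at `0`, since `rho` and `rho'` vanish there. -/
theorem eulerMaclaurin_eq (M : ℕ) : eulerMaclaurin A M = 1 / 12 * rhoDeriv A M
    - 1 / 2 * ∫ v in (0 : ℝ)..M, periodicBernoulli v * rhoDeriv2 A v := by
  induction M with
  | zero => simp [eulerMaclaurin, rho_zero, rhoDeriv_zero]
  | succ M ih =>
    have hM : (0 : ℝ) ≤ M := by positivity
    have hle : (M : ℝ) ≤ (M + 1 : ℕ) := by push_cast; linarith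
    have h1 := intervalIntegral.integral_add_adjacent_intervals
      (intervalIntegrable_rho hA le_rfl hM) (intervalIntegrable_rho hA hM hle)
    have h2 := intervalIntegral.integral_add_adjacent_intervals
      (intervalIntegrable_periodicBernoulli_mul_rhoDeriv2 hA le_rfl hM)
      (intervalIntegrable_periodicBernoulli_mul_rhoDeriv2 hA hM hle)
    have h3 := integral_periodicBernoulli_mul_rhoDeriv2_Icc hA M
    unfold eulerMaclaurin at ih ⊢
    rw [Finset.sum_range_succ, ← h1, ← h2, h3]
    linear_combination ih

theorem norm_rhoDeriv_le {v : ℝ} (hv : 0 ≤ v) :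
    ‖rhoDeriv A v‖ ≤ ∫ v in Ioi (0 : ℝ), ‖rhoDeriv2 A v‖ := by
  have h := intervalIntegral.integral_eq_sub_of_hasDerivAt_of_le hv
    ((continuousOn_rhoDeriv hA).mono fun x hx => hx.1)
    (fun x hx => hasDerivAt_rhoDeriv A (ne_of_gt hx.1)) (intervalIntegrable_rhoDeriv2 hA le_rfl hv)
  rw [rhoDeriv_zero, sub_zero] at h
  rw [← h, intervalIntegral.integral_of_le hv]
  refine (norm_integral_le_integral_norm _).trans ?_
  exact setIntegral_mono_set (integrableOn_rhoDeriv2 hA).norm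
    (Eventually.of_forall fun _ => norm_nonneg _)
    (Eventually.of_forall fun x hx => hx.1)

theorem norm_eulerMaclaurin_le (M : ℕ) :
    ‖eulerMaclaurin A M‖ ≤ 1 / A ^ 2 * ∫ v in Ioi (0 : ℝ), ‖rhoDeriv2 1 v‖ := by
  rw [← integral_norm_rhoDeriv2 hA, eulerMaclaurin_eq hA]
  have hM : (0 : ℝ) ≤ M := by positivity
  have h1 := norm_rhoDeriv_le hA hM
  have h2 : ‖∫ v in (0 : ℝ)..M, periodicBernoulli v * rhoDeriv2 A v‖
      ≤ ∫ v in Ioi (0 : ℝ), ‖rhoDeriv2 A v‖ := by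
    rw [intervalIntegral.integral_of_le hM]
    refine (norm_integral_le_of_norm_le (g := fun v => ‖rhoDeriv2 A v‖) ?_ ?_).trans ?_
    · exact ((integrableOn_rhoDeriv2 hA).mono_set fun x hx => hx.1).norm
    · refine Eventually.of_forall fun v => ?_
      rw [norm_mul]
      exact mul_le_of_le_one_left (norm_nonneg _) (abs_periodicBernoulli_le v)
    · exact setIntegral_mono_set (integrableOn_rhoDeriv2 hA).norm
        (Eventually.of_forall fun _ => norm_nonneg _)
        (Eventually.of_forall fun x hx => hx.1)
  refine (norm_sub_le _ _).trans ?_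
  rw [norm_mul, norm_mul]
  have h3 : ‖(1 / 12 : ℝ)‖ = 1 / 12 := by norm_num
  have h4 : ‖(1 / 2 : ℝ)‖ = 1 / 2 := by norm_num
  rw [h3, h4]
  have h5 : 0 ≤ ∫ v in Ioi (0 : ℝ), ‖rhoDeriv2 A v‖ := (norm_nonneg _).trans h1
  linarith

theorem tendsto_eulerMaclaurin : Tendsto (eulerMaclaurin A) atTop
    (𝓝 (-(1 / 2 * ∫ v in Ioi (0 : ℝ), periodicBernoulli v * rhoDeriv2 A v))) := by
  have h1 := ((tendsto_rhoDeriv_atTop A).comp tendsto_natCast_atTop_atTop).const_mul (1 / 12)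
  have h2 := (intervalIntegral_tendsto_integral_Ioi 0
    (integrableOn_periodicBernoulli_mul_rhoDeriv2 hA) tendsto_natCast_atTop_atTop).const_mul (1 / 2)
  have h3 := h1.sub h2
  rw [mul_zero, zero_sub] at h3
  exact h3.congr fun M => (eulerMaclaurin_eq hA M).symm

end

/-! ### Convergence and partial summation of the dual series -/

theorem summable_one_div_two_pi_mul_sq :
    Summable fun b : ℕ => 1 / (2 * Real.pi * (b + 1 : ℕ)) ^ 2 := by
  have h := (summable_nat_add_iff 1).2 (Real.summable_one_div_nat_pow.2 one_lt_two)
  refine (h.mul_left (1 / (2 * Real.pi) ^ 2)).congr fun b => ?_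
  have := Real.pi_ne_zero
  field_simp

theorem norm_dualTerm_le {k : ℝ} (hk : 0 < k) (a b : ℕ) :
    ‖dualTerm k (a + 1) (b + 1)‖ ≤ 1 / (2 * Real.pi * (a + 1 : ℕ)) ^ 2 *
      (1 / (2 * Real.pi * (b + 1 : ℕ)) ^ 2) *
      (1 / k ^ 2 * ∫ v in Ioi (0 : ℝ), ‖rhoDeriv2 1 v‖) := by
  have hA : 0 < 2 * Real.pi * (a + 1 : ℕ) * k := by positivity
  have h : ‖∫ v in Ioi (0 : ℝ), Real.cos (2 * Real.pi * (b + 1 : ℕ) * v) *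
      rhoDeriv2 (2 * Real.pi * (a + 1 : ℕ) * k) v‖
      ≤ ∫ v in Ioi (0 : ℝ), ‖rhoDeriv2 (2 * Real.pi * (a + 1 : ℕ) * k) v‖ := by
    refine norm_integral_le_of_norm_le (integrableOn_rhoDeriv2 hA).norm
      (Eventually.of_forall fun v => ?_)
    rw [norm_mul]
    exact mul_le_of_le_one_left (norm_nonneg _) (Real.abs_cos_le_one _)
  rw [integral_norm_rhoDeriv2 hA] at h
  rw [dualTerm, norm_mul, norm_neg, Real.norm_of_nonneg (by positivity)]
  refine (mul_le_mul_of_nonneg_left h (by positivity)).trans (le_of_eq ?_)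
  rw [mul_pow _ k, ← one_div_mul_one_div]
  ring

theorem summable_dualTerm {k : ℝ} (hk : 0 < k) :
    Summable fun p : ℕ × ℕ => dualTerm k (p.1 + 1) (p.2 + 1) := by
  have h := summable_one_div_two_pi_mul_sq
  refine Summable.of_norm_bounded ((h.mul_of_nonneg h (fun _ => by positivity)
    (fun _ => by positivity)).mul_right _) fun p => norm_dualTerm_le hk p.1 p.2

/-- Under the integral, the cosines add up to a quarter of the periodic Bernoulli polynomial. -/
theorem hasSum_dualTerm {k : ℝ} (hk : 0 < k) (a : ℕ) :
    HasSum (fun b : ℕ => dualTerm k (a + 1) (b + 1)) (-(1 / 4 * ∫ v in Ioi (0 : ℝ),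
      periodicBernoulli v * rhoDeriv2 (2 * Real.pi * (a + 1 : ℕ) * k) v)) := by
  have hA : 0 < 2 * Real.pi * (a + 1 : ℕ) * k := by positivity
  set A := 2 * Real.pi * (a + 1 : ℕ) * k with hAdef
  have hi := integrableOn_rhoDeriv2 hA
  have hF : ∀ b : ℕ, Integrable (fun v => (1 / (2 * Real.pi * (b + 1 : ℕ)) ^ 2 *
      Real.cos (2 * Real.pi * (b + 1 : ℕ) * v)) * rhoDeriv2 A v) (volume.restrict (Ioi 0)) := by
    intro b
    refine hi.bdd_mul (c := 1 / (2 * Real.pi * (b + 1 : ℕ)) ^ 2)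
      (Continuous.aestronglyMeasurable (by fun_prop)) (Eventually.of_forall fun v => ?_)
    rw [norm_mul, Real.norm_of_nonneg (by positivity)]
    exact mul_le_of_le_one_right (by positivity) (Real.abs_cos_le_one _)
  have h := hasSum_integral_of_summable_integral_norm hF ?_
  · have e1 : ∀ b : ℕ, ∫ v in Ioi (0 : ℝ), (1 / (2 * Real.pi * (b + 1 : ℕ)) ^ 2 *
        Real.cos (2 * Real.pi * (b + 1 : ℕ) * v)) * rhoDeriv2 A v
        = -dualTerm k (a + 1) (b + 1) := by
      intro b
      rw [dualTerm, ← hAdef, neg_mul, neg_neg, ← integral_const_mul]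
      simp_rw [mul_assoc]
    have e2 : ∫ v in Ioi (0 : ℝ), (∑' b : ℕ, (1 / (2 * Real.pi * (b + 1 : ℕ)) ^ 2 *
        Real.cos (2 * Real.pi * (b + 1 : ℕ) * v)) * rhoDeriv2 A v)
        = 1 / 4 * ∫ v in Ioi (0 : ℝ), periodicBernoulli v * rhoDeriv2 A v := by
      rw [← integral_const_mul]
      refine integral_congr_ae (Eventually.of_forall fun v => ?_)
      simp only
      rw [((hasSum_cos_div_sq v).mul_right _).tsum_eq]
      ring
    rw [e2] at h
    simp only [e1] at h
    simpa using h.neg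
  · refine Summable.of_nonneg_of_le (fun b => integral_nonneg fun _ => norm_nonneg _) (fun b => ?_)
      (summable_one_div_two_pi_mul_sq.mul_right (∫ v in Ioi (0 : ℝ), ‖rhoDeriv2 A v‖))
    rw [← integral_const_mul]
    refine integral_mono (hF b).norm (hi.norm.const_mul _) fun v => ?_
    simp only
    rw [norm_mul, norm_mul, Real.norm_of_nonneg (by positivity)]
    refine mul_le_mul_of_nonneg_right ?_ (norm_nonneg _)
    exact mul_le_of_le_one_right (by positivity) (Real.abs_cos_le_one _)

theorem summable_eulerMaclaurin {k : ℝ} (hk : 0 < k) (M : ℕ) :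
    Summable fun a : ℕ => eulerMaclaurin (2 * Real.pi * (a + 1 : ℕ) * k) M := by
  refine Summable.of_norm_bounded (summable_one_div_two_pi_mul_sq.mul_right
    (1 / k ^ 2 * ∫ v in Ioi (0 : ℝ), ‖rhoDeriv2 1 v‖)) fun a => ?_
  refine (norm_eulerMaclaurin_le (by positivity) M).trans (le_of_eq ?_)
  rw [mul_pow _ k, ← one_div_mul_one_div]
  ring

/-- The bound on the remainder is uniform in `M` and summable in `a`, so dominated convergence
applies. The factor `2` is the ratio of `1 / 2` in `tendsto_eulerMaclaurin` to `1 / 4` in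
`hasSum_dualTerm`. -/
theorem tendsto_tsum_eulerMaclaurin {k : ℝ} (hk : 0 < k) :
    Tendsto (fun M : ℕ => ∑' a : ℕ, eulerMaclaurin (2 * Real.pi * (a + 1 : ℕ) * k) M) atTop
      (𝓝 (2 * ∑' p : ℕ × ℕ, dualTerm k (p.1 + 1) (p.2 + 1))) := by
  rw [(summable_dualTerm hk).tsum_prod' (fun a => (hasSum_dualTerm hk a).summable), ← tsum_mul_left]
  refine tendsto_tsum_of_dominated_convergence (summable_one_div_two_pi_mul_sq.mul_right
    (1 / k ^ 2 * ∫ v in Ioi (0 : ℝ), ‖rhoDeriv2 1 v‖)) (fun a => ?_)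
    (Eventually.of_forall fun M a => ?_)
  · rw [(hasSum_dualTerm hk a).tsum_eq]
    convert! tendsto_eulerMaclaurin (A := 2 * Real.pi * (a + 1 : ℕ) * k) (by positivity) using 2
    ring
  · refine (norm_eulerMaclaurin_le (by positivity) M).trans (le_of_eq ?_)
    rw [mul_pow _ k, ← one_div_mul_one_div]
    ring

/-! ### Asymptotics of an arctangent sum -/

theorem arctan_mul_div_eq {c x : ℝ} (hx : x ≠ 0) :
    Real.arctan (c * x) / x = ∫ t in (0 : ℝ)..c, 1 / (1 + (t * x) ^ 2) := by
  have := intervalIntegral.integral_comp_mul_right (a := 0) (b := c)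
    (fun t : ℝ => 1 / (1 + t ^ 2)) hx
  rw [this, zero_mul, integral_one_div_one_add_sq, Real.arctan_zero, sub_zero, smul_eq_mul]
  field_simp

theorem antitoneOn_arctan_mul_div {c : ℝ} (hc : 0 ≤ c) :
    AntitoneOn (fun x : ℝ => Real.arctan (c * x) / x) (Ioi 0) := by
  intro x hx y hy hxy
  have hx : 0 < x := hx
  have hy : 0 < y := hy
  simp only
  rw [arctan_mul_div_eq hx.ne', arctan_mul_div_eq hy.ne']
  have hi : ∀ z : ℝ, IntervalIntegrable (fun t : ℝ => 1 / (1 + (t * z) ^ 2)) volume 0 c := fun z =>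
    (Continuous.div continuous_const (by fun_prop) fun t => by positivity).intervalIntegrable _ _
  refine intervalIntegral.integral_mono_on hc (hi y) (hi x) fun t ht => ?_
  have := ht.1
  gcongr

theorem antitoneOn_arctan_div_div {c : ℝ} (hc : 0 ≤ c) :
    AntitoneOn (fun x : ℝ => Real.arctan (c / x) / x) (Ioi 0) := by
  intro x hx y hy hxy
  have hx : 0 < x := hx
  have hy : 0 < y := hy
  simp only
  have h1 : Real.arctan (c / y) ≤ Real.arctan (c / x) :=
    Real.arctan_strictMono.monotone (by gcongr)
  have h2 : 0 ≤ Real.arctan (c / y) := Real.arctan_nonneg.2 (by positivity)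
  gcongr

theorem arctan_le_self {x : ℝ} (hx : 0 ≤ x) : Real.arctan x ≤ x := by
  rcases hx.eq_or_lt with rfl | hx
  · simp
  · simpa using (Real.lt_tan (Real.arctan_pos.2 hx) (Real.arctan_lt_pi_div_two x)).le

/-- The inversion `x ↦ N ^ 2 / x`. -/
theorem integral_arctan_div_div {N : ℝ} (hN : 1 ≤ N) :
    ∫ x in N..N ^ 2, Real.arctan (N / x) / x = ∫ x in (1 : ℝ)..N, Real.arctan (N⁻¹ * x) / x := by
  have hN0 : 0 < N := by linarith
  have hle : N ≤ N ^ 2 := by nlinarith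
  have h := intervalIntegral.integral_comp_mul_deriv_of_deriv_nonpos (a := N) (b := N ^ 2)
    (f := fun x => N ^ 2 * x⁻¹) (f' := fun x => N ^ 2 * -(x ^ 2)⁻¹)
    (g := fun x => Real.arctan (N⁻¹ * x) / x) ?_ ?_ ?_
  · have e1 : N ^ 2 * N⁻¹ = N := by field_simp
    have e2 : N ^ 2 * (N ^ 2)⁻¹ = 1 := by field_simp
    simp only [e1, e2] at h
    rw [intervalIntegral.integral_symm 1 N, ← neg_eq_iff_eq_neg,
      ← intervalIntegral.integral_neg] at h
    rw [← h]
    refine intervalIntegral.integral_congr fun x hx => ?_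
    rw [uIcc_of_le hle] at hx
    have hx0 : 0 < x := hN0.trans_le hx.1
    simp only [Function.comp]
    rw [show N⁻¹ * (N ^ 2 * x⁻¹) = N / x by field_simp]
    field_simp
  · rw [uIcc_of_le hle]
    exact ContinuousOn.mul continuousOn_const
      (continuousOn_inv₀.mono fun x hx => (hN0.trans_le hx.1).ne')
  · intro x hx
    rw [min_eq_left hle] at hx
    exact (hasDerivAt_inv (hN0.trans hx.1).ne').const_mul _
  · intro x hx
    have : 0 ≤ (x ^ 2)⁻¹ := by positivity
    nlinarith [sq_nonneg N]

/-- Both sums are compared with integrals of decreasing functions, and the inversion makes these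
integrals equal. The upper error consists of the two initial values, each at most `1 / N`. -/
theorem sum_arctan_sub_sum_arctan_mem {N : ℕ} (hN : 1 ≤ N) :
    (∑ j ∈ Finset.range N, Real.arctan ((N : ℝ)⁻¹ * (j + 1 : ℕ)) / (j + 1 : ℕ)
      - ∑ j ∈ Finset.Ico N (N ^ 2), Real.arctan (N / (j + 1 : ℕ)) / (j + 1 : ℕ))
      ∈ Icc 0 (2 * (1 / (N : ℝ))) := by
  have hN0 : (0 : ℝ) < N := by exact_mod_cast hN
  have hNN : N ≤ N ^ 2 := by nlinarith
  set w : ℝ → ℝ := fun x => Real.arctan ((N : ℝ)⁻¹ * x) / x with hw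
  set u : ℝ → ℝ := fun x => Real.arctan (N / x) / x with hu
  have hwanti : AntitoneOn w (Icc ((1 : ℕ) : ℝ) N) :=
    (antitoneOn_arctan_mul_div (by positivity)).mono fun x hx => by
      have := hx.1; simp at this; exact zero_lt_one.trans_le this
  have huanti : AntitoneOn u (Icc (N : ℝ) ((N ^ 2 : ℕ) : ℝ)) :=
    (antitoneOn_arctan_div_div hN0.le).mono fun x hx => hN0.trans_le hx.1
  have w1 := hwanti.integral_le_sum_Ico hN
  have w2 := hwanti.sum_le_integral_Ico hN
  have u1 := huanti.integral_le_sum_Ico hNN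
  have u2 := huanti.sum_le_integral_Ico hNN
  have hI : ∫ x in (N : ℝ)..((N ^ 2 : ℕ) : ℝ), u x = ∫ x in ((1 : ℕ) : ℝ)..N, w x := by
    have := integral_arctan_div_div (N := N) (by exact_mod_cast hN)
    push_cast
    exact this
  have P1 : ∑ j ∈ Finset.range N, w (j + 1 : ℕ) = w (1 : ℕ) + ∑ j ∈ Finset.Ico 1 N, w (j + 1 : ℕ) := by
    rw [Finset.range_eq_Ico, Finset.sum_eq_sum_Ico_succ_bot (by omega)]
  have T1 : ∑ j ∈ Finset.Ico 1 N, (w (j + 1 : ℕ) - w j) = w N - w (1 : ℕ) :=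
    Finset.sum_Ico_sub (fun j : ℕ => w j) hN
  have T2 : ∑ j ∈ Finset.Ico N (N ^ 2), (u (j + 1 : ℕ) - u j) = u (N ^ 2 : ℕ) - u N :=
    Finset.sum_Ico_sub (fun j : ℕ => u j) hNN
  rw [Finset.sum_sub_distrib] at T1 T2
  have b1 : w (1 : ℕ) ≤ 1 / N := by
    have := arctan_le_self (inv_nonneg.2 hN0.le)
    simpa [hw] using this
  have b2 : u N ≤ 1 / N := by
    simp only [hu]
    rw [div_self hN0.ne', Real.arctan_one]
    gcongr
    linarith [Real.pi_lt_four]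
  have b3 : 0 ≤ w N := div_nonneg (Real.arctan_nonneg.2 (by positivity)) hN0.le
  have b4 : 0 ≤ u (N ^ 2 : ℕ) := div_nonneg (Real.arctan_nonneg.2 (by positivity)) (by positivity)
  change (∑ j ∈ Finset.range N, w (j + 1 : ℕ) - ∑ j ∈ Finset.Ico N (N ^ 2), u (j + 1 : ℕ)) ∈ _
  rw [P1]
  exact ⟨by linarith, by linarith⟩

/-- `∑_{j ≥ 1} arctan (x / j) / j` -/
def arctanSum (x : ℝ) : ℝ := ∑' j : ℕ, Real.arctan (x / (j + 1 : ℕ)) / (j + 1 : ℕ)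

theorem arctan_div_div_le {x : ℝ} (hx : 0 ≤ x) (j : ℕ) :
    Real.arctan (x / (j + 1 : ℕ)) / (j + 1 : ℕ) ≤ x * (1 / ((j + 1 : ℕ) : ℝ) ^ 2) := by
  have := arctan_le_self (x := x / (j + 1 : ℕ)) (by positivity)
  rw [div_le_iff₀ (by positivity)]
  refine this.trans (le_of_eq ?_)
  field_simp

theorem summable_one_div_succ_sq : Summable fun j : ℕ => 1 / ((j + 1 : ℕ) : ℝ) ^ 2 :=
  (summable_nat_add_iff 1).2 (Real.summable_one_div_nat_pow.2 one_lt_two)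

theorem arctan_div_div_nonneg {x : ℝ} (hx : 0 ≤ x) (j : ℕ) :
    0 ≤ Real.arctan (x / (j + 1 : ℕ)) / (j + 1 : ℕ) :=
  div_nonneg (Real.arctan_nonneg.2 (by positivity)) (by positivity)

theorem summable_arctan_div_div {x : ℝ} (hx : 0 ≤ x) :
    Summable fun j : ℕ => Real.arctan (x / (j + 1 : ℕ)) / (j + 1 : ℕ) :=
  Summable.of_nonneg_of_le (arctan_div_div_nonneg hx)
    (arctan_div_div_le hx) (summable_one_div_succ_sq.mul_left x)

theorem tsum_one_div_sq_tail_le {J : ℕ} (hJ : 1 ≤ J) :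
    ∑' j : ℕ, 1 / ((j + J + 1 : ℕ) : ℝ) ^ 2 ≤ 1 / (J : ℝ) := by
  have hJ' : (0 : ℝ) < J := by exact_mod_cast hJ
  refine Real.tsum_le_of_sum_range_le (fun _ => by positivity) fun n => ?_
  have : ∑ i ∈ Finset.range n, 1 / ((i + J + 1 : ℕ) : ℝ) ^ 2 ≤ 1 / (J : ℝ) - 1 / ((n + J : ℕ) : ℝ) := by
    induction n with
    | zero => simp
    | succ n ih =>
      rw [Finset.sum_range_succ]
      have hn : (0 : ℝ) < (n + J : ℕ) := by positivity
      have : 1 / ((n + J + 1 : ℕ) : ℝ) ^ 2 ≤ 1 / ((n + J : ℕ) : ℝ) - 1 / ((n + 1 + J : ℕ) : ℝ) := by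
        push_cast at hn ⊢
        rw [div_sub_div _ _ (by positivity) (by positivity), div_le_div_iff₀ (by positivity)
          (by positivity)]
        nlinarith
      linarith
  have : 0 ≤ 1 / ((n + J : ℕ) : ℝ) := by positivity
  linarith

/-- For `j ≤ N`, `arctan (N / j) = π / 2 - arctan (j / N)` yields `(π / 2) H_N`. The correction
cancels against the terms with `N < j ≤ N ^ 2` up to `2 / N`, and the tail beyond `N ^ 2` is at most
`1 / N`. -/
theorem tendsto_arctanSum_sub_log :
    Tendsto (fun N : ℕ => arctanSum N - Real.pi / 2 * Real.log N) atTop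
      (𝓝 (Real.pi / 2 * Real.eulerMascheroniConstant)) := by
  have h1 := Real.tendsto_harmonic_sub_log.const_mul (Real.pi / 2)
  have h2 : Tendsto (fun N : ℕ => 3 * (1 / (N : ℝ))) atTop (𝓝 0) := by
    simpa using (tendsto_one_div_atTop_nhds_zero_nat (𝕜 := ℝ)).const_mul 3
  have h3 : Tendsto (fun N : ℕ => arctanSum N - Real.pi / 2 * Real.log N
      - Real.pi / 2 * (harmonic N - Real.log N)) atTop (𝓝 0) := by
    refine squeeze_zero_norm' ?_ h2
    filter_upwards [eventually_ge_atTop 1] with N hN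
    have hN' : (0 : ℝ) < N := by exact_mod_cast hN
    have hNN : N ≤ N ^ 2 := by nlinarith
    have e1 : arctanSum N = ∑ j ∈ Finset.range (N ^ 2), Real.arctan (N / (j + 1 : ℕ)) / (j + 1 : ℕ)
        + ∑' j : ℕ, Real.arctan (N / (j + N ^ 2 + 1 : ℕ)) / (j + N ^ 2 + 1 : ℕ) :=
      ((summable_arctan_div_div hN'.le).sum_add_tsum_nat_add (N ^ 2)).symm
    have e2 : ∑ j ∈ Finset.range (N ^ 2), Real.arctan ((N : ℝ) / (j + 1 : ℕ)) / (j + 1 : ℕ)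
        = ∑ j ∈ Finset.range N, Real.arctan ((N : ℝ) / (j + 1 : ℕ)) / (j + 1 : ℕ)
        + ∑ j ∈ Finset.Ico N (N ^ 2), Real.arctan ((N : ℝ) / (j + 1 : ℕ)) / (j + 1 : ℕ) :=
      (Finset.sum_range_add_sum_Ico _ hNN).symm
    have e3 : ∑ j ∈ Finset.range N, Real.arctan ((N : ℝ) / (j + 1 : ℕ)) / (j + 1 : ℕ)
        = Real.pi / 2 * harmonic N
          - ∑ j ∈ Finset.range N, Real.arctan ((N : ℝ)⁻¹ * (j + 1 : ℕ)) / (j + 1 : ℕ) := by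
      rw [harmonic]
      push_cast
      rw [Finset.mul_sum, ← Finset.sum_sub_distrib]
      refine Finset.sum_congr rfl fun j _ => ?_
      have hj : (0 : ℝ) < j + 1 := by positivity
      have := Real.arctan_inv_of_pos (x := (N : ℝ)⁻¹ * (j + 1)) (by positivity)
      rw [mul_inv, inv_inv, ← div_eq_mul_inv] at this
      rw [this]
      field_simp
    have e4 := sum_arctan_sub_sum_arctan_mem hN
    have hs := (summable_nat_add_iff (N ^ 2)).2 (summable_arctan_div_div hN'.le)
    have e5 : ∑' j : ℕ, Real.arctan (N / (j + N ^ 2 + 1 : ℕ)) / (j + N ^ 2 + 1 : ℕ) ≤ 1 / (N : ℝ) := by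
      have := tsum_one_div_sq_tail_le (J := N ^ 2) (by nlinarith)
      have h := mul_le_mul_of_nonneg_left this hN'.le
      rw [← tsum_mul_left] at h
      refine (hs.tsum_le_tsum (fun j => arctan_div_div_le hN'.le (j + N ^ 2))
        (((summable_nat_add_iff (N ^ 2)).2 summable_one_div_succ_sq).mul_left _)).trans
        (h.trans (le_of_eq ?_))
      push_cast
      field_simp
    have e6 : 0 ≤ ∑' j : ℕ, Real.arctan (N / (j + N ^ 2 + 1 : ℕ)) / (j + N ^ 2 + 1 : ℕ) :=
      tsum_nonneg fun j => arctan_div_div_nonneg hN'.le (j + N ^ 2)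
    rw [e1, e2, e3, Real.norm_eq_abs]
    rw [abs_le]
    constructor <;> linarith [e4.1, e4.2]
  have h4 := h3.add h1
  rw [zero_add] at h4
  exact h4.congr fun N => by ring

/-! ### The geometric series over `a`, its partial fractions and its regularised integral -/

/-- The sum over `a ≥ 1` of `rho (2 π a k) v`. -/
def rhoSum (k v : ℝ) : ℝ := 1 / (v * (Real.exp (2 * Real.pi * k / v) - 1))

section
variable {k : ℝ} (hk : 0 < k)
include hk

theorem hasSum_rho {v : ℝ} (hv : 0 < v) :
    HasSum (fun a : ℕ => rho (2 * Real.pi * (a + 1 : ℕ) * k) v) (rhoSum k v) := by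
  set x := Real.exp (-(2 * Real.pi * k / v)) with hx
  have hx1 : x < 1 := by
    rw [hx, Real.exp_lt_one_iff]
    have : 0 < 2 * Real.pi * k / v := by positivity
    linarith
  have h := (hasSum_geometric_of_lt_one (r := x) (Real.exp_pos _).le hx1).mul_left (x / v)
  convert! h using 1
  · ext a
    rw [rho, hx, ← Real.exp_nat_mul, div_mul_eq_mul_div, ← Real.exp_add]
    congr 2
    push_cast
    field_simp
    ring
  · have h1 : Real.exp (2 * Real.pi * k / v) = x⁻¹ := by rw [hx, Real.exp_neg, inv_inv]
    have hx0 : 0 < x := Real.exp_pos _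
    rw [rhoSum, h1]
    have : 1 - x ≠ 0 := by linarith
    field_simp

theorem rhoSum_nonneg {v : ℝ} (hv : 0 ≤ v) : 0 ≤ rhoSum k v := by
  have : 1 ≤ Real.exp (2 * Real.pi * k / v) := Real.one_le_exp (by positivity)
  exact div_nonneg zero_le_one (mul_nonneg hv (by linarith))

theorem rhoSum_le {v : ℝ} (hv : 0 < v) : rhoSum k v ≤ 1 / (2 * Real.pi * k) := by
  have h := Real.add_one_le_exp (2 * Real.pi * k / v)
  refine one_div_le_one_div_of_le (by positivity) ?_
  have := mul_le_mul_of_nonneg_left h hv.le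
  have e : v * (2 * Real.pi * k / v + 1) = 2 * Real.pi * k + v := by field_simp
  linarith

omit hk in
theorem measurable_rhoSum (k : ℝ) : Measurable (rhoSum k) := by
  unfold rhoSum
  fun_prop

theorem intervalIntegrable_rhoSum {a b : ℝ} (ha : 0 ≤ a) (hab : a ≤ b) :
    IntervalIntegrable (rhoSum k) volume a b := by
  rw [intervalIntegrable_iff_integrableOn_Ioc_of_le hab]
  refine Measure.integrableOn_of_bounded (M := 1 / (2 * Real.pi * k)) measure_Ioc_lt_top.ne
    (measurable_rhoSum k).aestronglyMeasurable ?_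
  refine (ae_restrict_mem measurableSet_Ioc).mono fun v hv => ?_
  have hv : 0 < v := ha.trans_lt hv.1
  rw [Real.norm_of_nonneg (rhoSum_nonneg hk hv.le)]
  exact rhoSum_le hk hv

theorem hasSum_eulerMaclaurin {M : ℕ} (hM : 1 ≤ M) :
    HasSum (fun a : ℕ => eulerMaclaurin (2 * Real.pi * (a + 1 : ℕ) * k) M)
      (∑ m ∈ Finset.range M, rhoSum k (m + 1 : ℕ) - 1 / 2 * rhoSum k M
        - ∫ v in (0 : ℝ)..M, rhoSum k v) := by
  have hM0 : (0 : ℝ) < M := by exact_mod_cast hM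
  have hA : ∀ a : ℕ, 0 < 2 * Real.pi * (a + 1 : ℕ) * k := fun a => by positivity
  have h1 : HasSum (fun a : ℕ =>
      ∑ m ∈ Finset.range M, rho (2 * Real.pi * (a + 1 : ℕ) * k) (m + 1 : ℕ)
        - 1 / 2 * rho (2 * Real.pi * (a + 1 : ℕ) * k) M)
      (∑ m ∈ Finset.range M, rhoSum k (m + 1 : ℕ) - 1 / 2 * rhoSum k M) :=
    (hasSum_sum fun m _ => hasSum_rho hk (by positivity)).sub
      ((hasSum_rho hk hM0).mul_left (1 / 2))
  -- The integrals are not estimated: they are summable as the difference of two summable families.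
  have h2 : Summable fun a : ℕ => ∫ v in Ioc (0 : ℝ) M, rho (2 * Real.pi * (a + 1 : ℕ) * k) v := by
    refine (h1.summable.sub (summable_eulerMaclaurin hk M)).congr fun a => ?_
    rw [eulerMaclaurin, intervalIntegral.integral_of_le hM0.le]
    ring
  have h3 := hasSum_integral_of_summable_integral_norm
    (F := fun (a : ℕ) (v : ℝ) => rho (2 * Real.pi * (a + 1 : ℕ) * k) v)
    (μ := volume.restrict (Ioc (0 : ℝ) M)) (fun a =>
      (intervalIntegrable_iff_integrableOn_Ioc_of_le hM0.le).1
        (intervalIntegrable_rho (hA a) le_rfl hM0.le)) ?_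
  · have e : ∫ v in Ioc (0 : ℝ) M, (∑' a : ℕ, rho (2 * Real.pi * (a + 1 : ℕ) * k) v)
        = ∫ v in (0 : ℝ)..M, rhoSum k v := by
      rw [intervalIntegral.integral_of_le hM0.le]
      exact setIntegral_congr_fun measurableSet_Ioc fun v hv => (hasSum_rho hk hv.1).tsum_eq
    rw [e] at h3
    refine (h1.sub h3).congr_fun fun a => ?_
    rw [eulerMaclaurin, intervalIntegral.integral_of_le hM0.le]
  · refine h2.congr fun a => setIntegral_congr_fun measurableSet_Ioc fun v hv => ?_
    rw [Real.norm_of_nonneg]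
    exact div_nonneg (Real.exp_pos _).le hv.1.le

/-- `∑_{j ≥ 1} k / (k ^ 2 + (j v) ^ 2)` -/
def poissonSum (k v : ℝ) : ℝ := ∑' j : ℕ, k / (k ^ 2 + ((j + 1 : ℕ) * v) ^ 2)

theorem poisson_term_le {v : ℝ} (hv : 0 < v) (j : ℕ) :
    k / (k ^ 2 + ((j + 1 : ℕ) * v) ^ 2) ≤ k / v ^ 2 * (1 / ((j + 1 : ℕ) : ℝ) ^ 2) := by
  rw [div_mul_div_comm, mul_one]
  gcongr
  nlinarith [sq_nonneg k]

theorem summable_poisson {v : ℝ} (hv : 0 < v) :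
    Summable fun j : ℕ => k / (k ^ 2 + ((j + 1 : ℕ) * v) ^ 2) :=
  Summable.of_nonneg_of_le (fun _ => by positivity) (poisson_term_le hk hv)
    (summable_one_div_succ_sq.mul_left _)

theorem poissonSum_nonneg (v : ℝ) : 0 ≤ poissonSum k v := tsum_nonneg fun _ => by positivity

theorem poissonSum_le {v : ℝ} (hv : 0 < v) :
    poissonSum k v ≤ k / v ^ 2 * ∑' j : ℕ, 1 / ((j + 1 : ℕ) : ℝ) ^ 2 := by
  rw [← tsum_mul_left]
  exact (summable_poisson hk hv).tsum_le_tsum (poisson_term_le hk hv)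
    (summable_one_div_succ_sq.mul_left _)

/-- The partial fraction expansion of the hyperbolic cotangent. -/
theorem rhoSum_eq {v : ℝ} (hv : 0 < v) :
    rhoSum k v = 1 / Real.pi * poissonSum k v - 1 / (2 * v) + 1 / (2 * Real.pi * k) := by
  obtain ⟨y, hy⟩ : ∃ y, y = k / v := ⟨_, rfl⟩
  have hy0 : 0 < y := hy ▸ by positivity
  have hz : (Complex.I * y : ℂ) ∈ Complex.integerComplement := by
    rintro ⟨n, hn⟩
    have := congrArg Complex.im hn
    simp at this
    linarith
  have h := cot_series_rep' hz
  obtain ⟨E, hE⟩ : ∃ E, E = Real.exp (2 * Real.pi * y) := ⟨_, rfl⟩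
  have hE1 : 1 < E := hE ▸ Real.one_lt_exp_iff.2 (by positivity)
  have hcot : Complex.cot (Real.pi * (Complex.I * y)) = -Complex.I * ((E + 1) / (E - 1) : ℝ) := by
    rw [Complex.cot_eq_exp_ratio]
    have : Complex.exp (2 * Complex.I * (Real.pi * (Complex.I * y))) = (E⁻¹ : ℝ) := by
      rw [hE, ← Real.exp_neg, Complex.ofReal_exp]
      congr 1
      push_cast
      linear_combination (2 * Real.pi * y : ℂ) * Complex.I_sq
    rw [this]
    have h1 : (E : ℂ) ≠ 0 := by exact_mod_cast (by linarith : E ≠ 0)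
    have h2 : (E : ℂ) - 1 ≠ 0 := by exact_mod_cast (by linarith : E - 1 ≠ 0)
    have h3 : (1 : ℂ) - (E : ℂ)⁻¹ ≠ 0 := by
      intro h; apply h2; field_simp at h; linear_combination h
    push_cast
    field_simp
    linear_combination ((E : ℂ) + 1) * Complex.I_sq
  have hterm : ∀ j : ℕ, 1 / (Complex.I * y - (j + 1)) + 1 / (Complex.I * y + (j + 1))
      = -(2 * Complex.I * v) * ((k / (k ^ 2 + ((j + 1 : ℕ) * v) ^ 2) : ℝ) : ℂ) := by
    intro j
    have hI : Complex.I ^ 2 = -1 := Complex.I_sq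
    have hj : (0 : ℝ) < (j + 1 : ℕ) := by positivity
    have n1 : (Complex.I * y - (j + 1) : ℂ) ≠ 0 := by
      intro h; have := congrArg Complex.im h; simp at this; linarith
    have n2 : (Complex.I * y + (j + 1) : ℂ) ≠ 0 := by
      intro h; have := congrArg Complex.im h; simp at this; linarith
    have n3 : ((k ^ 2 + ((j + 1 : ℕ) * v) ^ 2 : ℝ) : ℂ) ≠ 0 := by
      exact_mod_cast (by positivity : (k ^ 2 + ((j + 1 : ℕ) * v) ^ 2 : ℝ) ≠ 0)
    have hyv : (y : ℂ) * v = k := by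
      rw [← Complex.ofReal_mul, hy, div_mul_cancel₀ _ hv.ne']
    rw [div_add_div _ _ n1 n2, Complex.ofReal_div, ← mul_div_assoc,
      div_eq_div_iff (mul_ne_zero n1 n2) n3, ← hyv]
    push_cast
    rw [← hyv]
    linear_combination (2 * Complex.I * y ^ 3 * v ^ 2) * hI
  rw [tsum_congr hterm, tsum_mul_left, ← Complex.ofReal_tsum, hcot] at h
  change _ = _ * ((poissonSum k v : ℝ) : ℂ) at h
  have h' : Real.pi * ((E + 1) / (E - 1)) - 1 / y = 2 * v * poissonSum k v := by
    have hyc : (y : ℂ) ≠ 0 := by exact_mod_cast hy0.ne'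
    have e : (1 : ℂ) / (Complex.I * y) = -Complex.I * (1 / y) := by
      have := Complex.I_ne_zero
      field_simp
      linear_combination Complex.I_sq
    rw [e] at h
    apply Complex.ofReal_injective
    push_cast at h ⊢
    linear_combination Complex.I * h + (Real.pi * ((E + 1) / (E - 1)) - 1 / y
      - 2 * v * poissonSum k v : ℂ) * Complex.I_sq
  have hEk : Real.exp (2 * Real.pi * k / v) = E := by rw [hE, hy]; congr 1; ring
  rw [rhoSum, hEk]
  have hE2 : E - 1 ≠ 0 := by linarith
  have e2 : poissonSum k v = (Real.pi * ((E + 1) / (E - 1)) - 1 / y) / (2 * v) := by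
    rw [h']; field_simp
  rw [e2, hy]
  field_simp
  ring

theorem integrableOn_poissonSum {δ : ℝ} (hδ : 0 < δ) : IntegrableOn (poissonSum k) (Ioi δ) := by
  have h : IntegrableOn (fun v : ℝ => (k * ∑' j : ℕ, 1 / ((j + 1 : ℕ) : ℝ) ^ 2) * v ^ (-2 : ℝ))
      (Ioi δ) := (integrableOn_Ioi_rpow_of_lt (by norm_num) hδ).const_mul _
  refine h.mono' ?_ ?_
  -- The partial fraction identity, solved for `poissonSum`, supplies a measurable representative.
  · have hm : Measurable fun v : ℝ =>
        Real.pi * (rhoSum k v + 1 / (2 * v) - 1 / (2 * Real.pi * k)) := by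
      have := measurable_rhoSum k
      fun_prop
    refine hm.aestronglyMeasurable.congr ?_
    refine (ae_restrict_mem measurableSet_Ioi).mono fun v hv => ?_
    simp only
    rw [rhoSum_eq hk (hδ.trans hv)]
    field_simp
    ring
  · refine (ae_restrict_mem measurableSet_Ioi).mono fun v hv => ?_
    have hv : 0 < v := hδ.trans hv
    rw [Real.norm_of_nonneg (poissonSum_nonneg hk v)]
    refine (poissonSum_le hk hv).trans (le_of_eq ?_)
    rw [Real.rpow_neg hv.le]
    norm_num
    ring

theorem hasDerivAt_arctan_mul_div {j : ℝ} (hj : 0 < j) (v : ℝ) :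
    HasDerivAt (fun v : ℝ => Real.arctan (j * v / k) / j) (k / (k ^ 2 + (j * v) ^ 2)) v := by
  have h := ((((hasDerivAt_id v).const_mul j).div_const k).arctan).div_const j
  refine h.congr_deriv ?_
  simp only [id]
  field_simp

theorem tendsto_arctan_mul_div {j : ℝ} (hj : 0 < j) :
    Tendsto (fun v : ℝ => Real.arctan (j * v / k) / j) atTop (𝓝 (Real.pi / 2 / j)) := by
  have h1 : Tendsto (fun v : ℝ => j * v / k) atTop atTop :=
    (tendsto_id.const_mul_atTop hj).atTop_div_const hk
  exact ((tendsto_nhds_of_tendsto_nhdsWithin Real.tendsto_arctan_atTop).comp h1).div_const j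

theorem integral_poissonSum {δ : ℝ} (hδ : 0 < δ) :
    ∫ v in Ioi δ, poissonSum k v = arctanSum (k / δ) := by
  have hj : ∀ j : ℕ, (0 : ℝ) < (j + 1 : ℕ) := fun j => by positivity
  have hint : ∀ j : ℕ, IntegrableOn (fun v : ℝ => k / (k ^ 2 + ((j + 1 : ℕ) * v) ^ 2)) (Ioi δ) :=
    fun j => integrableOn_Ioi_deriv_of_nonneg' (fun v _ => hasDerivAt_arctan_mul_div hk (hj j) v)
      (fun v _ => by positivity) (tendsto_arctan_mul_div hk (hj j))
  have hval : ∀ j : ℕ, ∫ v in Ioi δ, k / (k ^ 2 + ((j + 1 : ℕ) * v) ^ 2)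
      = Real.arctan (k / δ / (j + 1 : ℕ)) / (j + 1 : ℕ) := by
    intro j
    have := hj j
    rw [integral_Ioi_of_hasDerivAt_of_nonneg' (fun v _ => hasDerivAt_arctan_mul_div hk (hj j) v)
      (fun v _ => by positivity) (tendsto_arctan_mul_div hk (hj j)), ← sub_div,
      ← Real.arctan_inv_of_pos (by positivity)]
    congr 2
    field_simp
  have h := hasSum_integral_of_summable_integral_norm hint ?_
  · simp only [hval] at h
    exact h.tsum_eq.symm
  · refine (summable_arctan_div_div (x := k / δ) (by positivity)).congr fun j => ?_
    rw [← hval j]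
    refine integral_congr_ae (Eventually.of_forall fun v => ?_)
    simp only
    rw [Real.norm_of_nonneg (by positivity)]

theorem integral_rhoSum {δ X : ℝ} (hδ : 0 < δ) (hX : δ ≤ X) :
    ∫ v in δ..X, rhoSum k v = 1 / Real.pi * (∫ v in δ..X, poissonSum k v)
      - 1 / 2 * (Real.log X - Real.log δ) + 1 / (2 * Real.pi * k) * (X - δ) := by
  have h0 : (0 : ℝ) ∉ uIcc δ X := by
    rw [uIcc_of_le hX]; exact fun h => absurd h.1 (not_le.2 hδ)
  have hi1 : IntervalIntegrable (fun v => 1 / Real.pi * poissonSum k v) volume δ X := by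
    rw [intervalIntegrable_iff_integrableOn_Ioc_of_le hX]
    exact ((integrableOn_poissonSum hk hδ).mono_set Ioc_subset_Ioi_self).const_mul _
  have hi2 : IntervalIntegrable (fun v : ℝ => 1 / 2 * (1 / v)) volume δ X :=
    (intervalIntegral.intervalIntegrable_one_div (fun x hx h => h0 (h ▸ hx))
      continuousOn_id).const_mul _
  have e : ∫ v in δ..X, rhoSum k v = ∫ v in δ..X,
      (1 / Real.pi * poissonSum k v - 1 / 2 * (1 / v) + 1 / (2 * Real.pi * k)) := by
    refine intervalIntegral.integral_congr fun v hv => ?_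
    rw [uIcc_of_le hX] at hv
    rw [rhoSum_eq hk (hδ.trans_le hv.1), div_mul_div_comm, one_mul]
  rw [e, intervalIntegral.integral_add (hi1.sub hi2) intervalIntegrable_const,
    intervalIntegral.integral_sub hi1 hi2, intervalIntegral.integral_const_mul,
    intervalIntegral.integral_const_mul, integral_one_div h0, intervalIntegral.integral_const,
    Real.log_div (hδ.trans_le hX).ne' hδ.ne', smul_eq_mul]
  ring

/-- Beyond `δ` the partial fractions cancel the growing terms and leave an integrable function. The
cut `δ` stays free so that it can later tend to `0`. -/
theorem tendsto_linear_sub_log_sub_integral_aux {δ : ℝ} (hδ : 0 < δ) :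
    Tendsto (fun M : ℕ => M / (2 * Real.pi * k) - 1 / 2 * Real.log M
      - ∫ v in (0 : ℝ)..M, rhoSum k v) atTop
      (𝓝 (δ / (2 * Real.pi * k) - 1 / 2 * Real.log δ - 1 / Real.pi * arctanSum (k / δ)
        - ∫ v in (0 : ℝ)..δ, rhoSum k v)) := by
  have h1 := intervalIntegral_tendsto_integral_Ioi δ (integrableOn_poissonSum hk hδ)
    tendsto_natCast_atTop_atTop
  rw [integral_poissonSum hk hδ] at h1
  have h2 := ((h1.const_mul (1 / Real.pi)).const_sub
    (δ / (2 * Real.pi * k) - 1 / 2 * Real.log δ)).sub_const (∫ v in (0 : ℝ)..δ, rhoSum k v)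
  refine h2.congr' ?_
  filter_upwards [eventually_ge_atTop ⌈δ⌉₊] with M hM
  have hM : δ ≤ M := Nat.ceil_le.1 hM
  rw [← intervalIntegral.integral_add_adjacent_intervals
    (intervalIntegrable_rhoSum hk le_rfl hδ.le) (intervalIntegrable_rhoSum hk hδ.le hM),
    integral_rhoSum hk hδ hM]
  ring

/-- The limit cannot depend on the cut. With `δ = k / N` and `N → ∞` the integral over `(0, δ)`
disappears, and `arctanSum N - (π / 2) log N` brings in Euler's constant. -/
theorem tendsto_linear_sub_log_sub_integral :
    Tendsto (fun M : ℕ => M / (2 * Real.pi * k) - 1 / 2 * Real.log M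
      - ∫ v in (0 : ℝ)..M, rhoSum k v) atTop
      (𝓝 (-(1 / 2 * Real.log k) - Real.eulerMascheroniConstant / 2)) := by
  set L := 1 / (2 * Real.pi * k) - 1 / 2 * Real.log 1 - 1 / Real.pi * arctanSum (k / 1)
        - ∫ v in (0 : ℝ)..1, rhoSum k v with hL
  have h0 := tendsto_linear_sub_log_sub_integral_aux hk one_pos
  rw [← hL] at h0
  have hconst : ∀ N : ℕ, 1 ≤ N → (1 / (2 * Real.pi)) * (1 / (N : ℝ)) - 1 / 2 * Real.log k
      - 1 / Real.pi * (arctanSum N - Real.pi / 2 * Real.log N)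
        - ∫ v in (0 : ℝ)..(k / N), rhoSum k v = L := by
    intro N hN
    have hN0 : (0 : ℝ) < N := by exact_mod_cast hN
    have := tendsto_nhds_unique
      (tendsto_linear_sub_log_sub_integral_aux hk (δ := k / N) (by positivity)) h0
    rw [← this, Real.log_div hk.ne' hN0.ne', div_div_cancel₀ hk.ne']
    field_simp
    ring
  have hz : Tendsto (fun N : ℕ => ∫ v in (0 : ℝ)..(k / N), rhoSum k v) atTop (𝓝 0) := by
    refine squeeze_zero_norm (a := fun N : ℕ => 1 / (2 * Real.pi) * (1 / (N : ℝ))) (fun N => ?_) ?_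
    · have h0N : (0 : ℝ) ≤ k / N := by positivity
      refine (intervalIntegral.norm_integral_le_of_norm_le_const (C := 1 / (2 * Real.pi * k))
        fun v hv => ?_).trans (le_of_eq ?_)
      · rw [uIoc_of_le h0N] at hv
        rw [Real.norm_of_nonneg (rhoSum_nonneg hk hv.1.le)]
        exact rhoSum_le hk hv.1
      · rw [sub_zero, abs_of_nonneg h0N]
        field_simp
    · simpa using (tendsto_one_div_atTop_nhds_zero_nat (𝕜 := ℝ)).const_mul (1 / (2 * Real.pi))
  have h1 := ((((tendsto_one_div_atTop_nhds_zero_nat (𝕜 := ℝ)).const_mul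
    (1 / (2 * Real.pi))).sub_const (1 / 2 * Real.log k)).sub
    (tendsto_arctanSum_sub_log.const_mul (1 / Real.pi))).sub hz
  have h2 : Tendsto (fun _ : ℕ => L) atTop (𝓝 L) := tendsto_const_nhds
  have h3 := tendsto_nhds_unique (h2.congr' (by
    filter_upwards [eventually_ge_atTop 1] with N hN using (hconst N hN).symm)) h1
  rw [h3] at h0
  convert! h0 using 2
  have := Real.pi_ne_zero
  field_simp
  ring

/-! ### The summation formula -/

/-- The terms of the double series `∑_{a, b ≥ 1} k / (k ^ 2 + (a b) ^ 2)`. -/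
def resolventTerm (k : ℝ) (p : ℕ × ℕ) : ℝ :=
  k / (k ^ 2 + ((p.2 + 1 : ℕ) * (p.1 + 1 : ℕ)) ^ 2)

theorem summable_resolventTerm : Summable (resolventTerm k) := by
  have h := summable_one_div_succ_sq
  refine Summable.of_nonneg_of_le (fun p => by unfold resolventTerm; positivity) (fun p => ?_)
    ((h.mul_of_nonneg h (fun _ => by positivity) (fun _ => by positivity)).mul_left k)
  have := poisson_term_le hk (v := (p.1 + 1 : ℕ)) (by positivity) p.2
  refine this.trans (le_of_eq ?_)
  ring

theorem tendsto_rhoSum : Tendsto (fun M : ℕ => rhoSum k M) atTop (𝓝 (1 / (2 * Real.pi * k))) := by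
  have h : Tendsto (fun M : ℕ => 1 / (2 * Real.pi * k) - 1 / 2 * (1 / (M : ℝ))) atTop
      (𝓝 (1 / (2 * Real.pi * k))) := by
    have := ((tendsto_one_div_atTop_nhds_zero_nat (𝕜 := ℝ)).const_mul (1 / 2)).const_sub
      (1 / (2 * Real.pi * k))
    rwa [mul_zero, sub_zero] at this
  refine tendsto_of_tendsto_of_tendsto_of_le_of_le' h tendsto_const_nhds ?_ ?_
  · filter_upwards [eventually_ge_atTop 1] with M hM
    have hM0 : (0 : ℝ) < M := by exact_mod_cast hM
    rw [rhoSum_eq hk hM0, div_mul_div_comm, one_mul]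
    have : 0 ≤ 1 / Real.pi * poissonSum k M := mul_nonneg (by positivity) (poissonSum_nonneg hk _)
    linarith
  · filter_upwards [eventually_ge_atTop 1] with M hM
    exact rhoSum_le hk (by exact_mod_cast hM)

/-- The Voronoi-Koshliakov summation formula for `d(n)` and `1 / (n ^ 2 + k ^ 2)`. -/
theorem two_pi_mul_tsum_dualTerm :
    2 * Real.pi * ∑' p : ℕ × ℕ, dualTerm k (p.1 + 1) (p.2 + 1)
      = ∑' p : ℕ × ℕ, resolventTerm k p
        - Real.pi / 2 * (Real.log k + 2 * Real.eulerMascheroniConstant) - 1 / (4 * k) := by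
  have hs := summable_resolventTerm hk
  have hH : Tendsto (fun M : ℕ => ∑ m ∈ Finset.range M, poissonSum k (m + 1 : ℕ)) atTop
      (𝓝 (∑' p : ℕ × ℕ, resolventTerm k p)) := by
    have h := hs.hasSum.prod_fiberwise fun a => (summable_poisson hk
      (v := (a + 1 : ℕ)) (by positivity)).hasSum
    exact h.tendsto_sum_nat
  have h1 := tendsto_tsum_eulerMaclaurin hk
  -- The terms `-1 / (2 m)` of the partial fractions give the harmonic numbers, hence the other half
  -- of `γ`; half of `rhoSum k M` tends to `1 / (4 π k)`.
  have h2 := (((hH.const_mul (1 / Real.pi)).add (tendsto_linear_sub_log_sub_integral hk)).sub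
    (Real.tendsto_harmonic_sub_log.const_mul (1 / 2))).sub ((tendsto_rhoSum hk).const_mul (1 / 2))
  have h3 := tendsto_nhds_unique (h1.congr' ?_) h2
  · have := Real.pi_ne_zero
    have h4 : 2 * Real.pi * ∑' p : ℕ × ℕ, dualTerm k (p.1 + 1) (p.2 + 1)
      = Real.pi * (2 * ∑' p : ℕ × ℕ, dualTerm k (p.1 + 1) (p.2 + 1)) := by ring
    rw [h4, h3]
    field_simp
    ring
  · filter_upwards [eventually_ge_atTop 1] with M hM
    rw [(hasSum_eulerMaclaurin hk hM).tsum_eq]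
    have e : ∑ m ∈ Finset.range M, rhoSum k (m + 1 : ℕ)
        = 1 / Real.pi * ∑ m ∈ Finset.range M, poissonSum k (m + 1 : ℕ)
          - 1 / 2 * (harmonic M : ℝ) + M / (2 * Real.pi * k) := by
      rw [harmonic]
      push_cast
      rw [Finset.mul_sum, Finset.mul_sum, ← Finset.sum_sub_distrib]
      have : (M : ℝ) / (2 * Real.pi * k) = ∑ _m ∈ Finset.range M, 1 / (2 * Real.pi * k) := by
        simp [div_eq_mul_inv]
      rw [this, ← Finset.sum_add_distrib]
      refine Finset.sum_congr rfl fun m _ => ?_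
      rw [rhoSum_eq hk (by positivity)]
      congr 2
      field_simp
    rw [e]
    ring

end

/-! ### The trace of the resolvent -/

theorem card_divisorsAntidiagonal (n : ℕ) : n.divisorsAntidiagonal.card = n.divisors.card := by
  rw [← Nat.map_div_right_divisors, Finset.card_map]

/-- The pairs with product `n` contribute `d(n)` equal terms, so absolute convergence permits
grouping the double series by products. -/
theorem hasSum_poTerm {k : ℝ} (hk : 0 < k) :
    HasSum (fun n : ℕ => k * poTerm n k) (∑' p : ℕ × ℕ, dualTerm k (p.1 + 1) (p.2 + 1)) := by
  have h1 : HasSum (fun x : ℕ+ × ℕ+ => dualTerm k x.1 x.2)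
      (∑' p : ℕ × ℕ, dualTerm k (p.1 + 1) (p.2 + 1)) := by
    rw [← (Equiv.pnatEquivNat.symm.prodCongr Equiv.pnatEquivNat.symm).hasSum_iff]
    exact (summable_dualTerm hk).hasSum
  have h2 := (sigmaAntidiagonalEquivProd.hasSum_iff.mpr h1).sigma
    (g := fun n : ℕ+ => k * poTerm n k) fun n => by
      have h3 : ∀ x : Nat.divisorsAntidiagonal n,
          dualTerm k (sigmaAntidiagonalEquivProd ⟨n, x⟩).1 (sigmaAntidiagonalEquivProd ⟨n, x⟩).2
            = k * ∫ p in Ioi (0 : ℝ), poIntegrand n k p := fun x => by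
        have h4 : (((sigmaAntidiagonalEquivProd ⟨n, x⟩).1 : ℕ+) : ℕ)
            * ((sigmaAntidiagonalEquivProd ⟨n, x⟩).2 : ℕ+) = n :=
          (Nat.mem_divisorsAntidiagonal.mp x.2).1
        rw [← mul_integral_poIntegrand_eq_dualTerm hk (PNat.pos _) (PNat.pos _), h4]
      convert! hasSum_fintype fun _ : Nat.divisorsAntidiagonal n =>
        k * ∫ p in Ioi (0 : ℝ), poIntegrand n k p using 1
      · exact funext h3
      simp only [Finset.sum_const, Finset.card_univ, Fintype.card_coe,
        card_divisorsAntidiagonal, poTerm, nsmul_eq_mul]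
      ring
  refine (PNat.coe_injective.hasSum_iff fun n hn => ?_).mp h2
  have h5 : n = 0 := by
    by_contra h
    exact hn ⟨⟨n, Nat.pos_of_ne_zero h⟩, rfl⟩
  simp [h5, poTerm]

theorem summable_poTerm {k : ℝ} (hk : 0 < k) : Summable fun n : ℕ => poTerm n k :=
  (summable_mul_left_iff hk.ne').mp (hasSum_poTerm hk).summable

theorem mul_Tpo {k : ℝ} (hk : 0 < k) :
    k * Tpo k = 2 * Real.pi * ∑' p : ℕ × ℕ, dualTerm k (p.1 + 1) (p.2 + 1) := by
  rw [← (hasSum_poTerm hk).tsum_eq, tsum_mul_left, Tpo]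
  ring

/-- The decay is taken from the dual series; in the resolvent formula it is hidden in the
cancellation of growing terms. -/
theorem exists_norm_mul_Tpo_le : ∃ C : ℝ, ∀ k : ℝ, 0 < k → ‖k * Tpo k‖ ≤ C * k ^ (-2 : ℝ) := by
  have h0 := summable_one_div_two_pi_mul_sq
  have h1 : Summable fun p : ℕ × ℕ => 1 / (2 * Real.pi * (p.1 + 1 : ℕ)) ^ 2
      * (1 / (2 * Real.pi * (p.2 + 1 : ℕ)) ^ 2) :=
    h0.mul_of_nonneg h0 (fun _ => by positivity) (fun _ => by positivity)
  refine ⟨2 * Real.pi * ((∑' p : ℕ × ℕ, 1 / (2 * Real.pi * (p.1 + 1 : ℕ)) ^ 2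
    * (1 / (2 * Real.pi * (p.2 + 1 : ℕ)) ^ 2)) * ∫ v in Ioi (0 : ℝ), ‖rhoDeriv2 1 v‖),
    fun k hk => ?_⟩
  rw [mul_Tpo hk, norm_mul, Real.norm_of_nonneg (by positivity : 0 ≤ 2 * Real.pi),
    mul_assoc (2 * Real.pi)]
  refine mul_le_mul_of_nonneg_left (?_ : _ ≤ _) (by positivity : 0 ≤ 2 * Real.pi)
  refine (tsum_of_norm_bounded (h1.mul_right _).hasSum fun p =>
    norm_dualTerm_le hk p.1 p.2).trans (le_of_eq ?_)
  rw [tsum_mul_right, Real.rpow_neg hk.le, Real.rpow_two]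
  ring

/-! ### An antiderivative of `2 k T^po(k)` -/

/-- The wavenumbers, each as often as it occurs. -/
def wavenumber (p : ℕ × ℕ) : ℝ := (p.2 + 1 : ℕ) * (p.1 + 1 : ℕ)

theorem wavenumber_pos (p : ℕ × ℕ) : 0 < wavenumber p := by unfold wavenumber; positivity

theorem summable_one_div_wavenumber_sq : Summable fun p => 1 / wavenumber p ^ 2 := by
  refine (summable_one_div_succ_sq.mul_of_nonneg summable_one_div_succ_sq
    (fun _ => by positivity) (fun _ => by positivity)).congr fun p => ?_
  rw [wavenumber, mul_pow, mul_comm, div_mul_div_comm, one_mul]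

theorem summable_sq_div_wavenumber_sq (s : ℝ) : Summable fun p => s ^ 2 / wavenumber p ^ 2 :=
  (summable_one_div_wavenumber_sq.mul_left (s ^ 2)).congr fun p => by ring

theorem summable_log_one_add_sq_div (s : ℝ) :
    Summable fun p => Real.log (1 + s ^ 2 / wavenumber p ^ 2) :=
  Real.summable_log_one_add_of_summable (summable_sq_div_wavenumber_sq s)

theorem hasDerivAt_tsum_log {s : ℝ} (hs : 0 < s) :
    HasDerivAt (fun s : ℝ => ∑' p, Real.log (1 + s ^ 2 / wavenumber p ^ 2))
      (2 * ∑' p, resolventTerm s p) s := by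
  rw [← tsum_mul_left]
  refine hasDerivAt_tsum_of_isPreconnected (t := Ioo 0 (s + 1)) (y₀ := s)
    (u := fun p => 2 * (s + 1) * (1 / wavenumber p ^ 2))
    (g' := fun p y => 2 * resolventTerm y p)
    (summable_one_div_wavenumber_sq.mul_left _) isOpen_Ioo isPreconnected_Ioo
    (fun p y hy => ?_) (fun p y hy => ?_) ⟨hs, by linarith⟩ (summable_log_one_add_sq_div s)
    ⟨hs, by linarith⟩
  · have h1 := wavenumber_pos p
    simp only [resolventTerm, ← wavenumber.eq_def]
    have h2 : HasDerivAt (fun y : ℝ => 1 + y ^ 2 / wavenumber p ^ 2)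
        (2 * y / wavenumber p ^ 2) y := by
      simpa using (((hasDerivAt_id y).pow 2).div_const (wavenumber p ^ 2)).const_add 1
    refine (h2.log (by positivity)).congr_deriv ?_
    field_simp
    ring
  · have h1 := wavenumber_pos p
    have hy0 := hy.1
    simp only [resolventTerm, ← wavenumber.eq_def]
    rw [Real.norm_of_nonneg (by positivity), mul_one_div, ← mul_div_assoc]
    gcongr
    · exact hy.2.le
    · nlinarith

/-- An antiderivative of `2 k T^po(k)`. -/
def logZeta (s : ℝ) : ℝ := (∑' p, Real.log (1 + s ^ 2 / wavenumber p ^ 2))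
  - Real.pi * (s * Real.log s + (2 * Real.eulerMascheroniConstant - 1) * s) - 1 / 2 * Real.log s

theorem hasDerivAt_logZeta {s : ℝ} (hs : 0 < s) : HasDerivAt logZeta (2 * (s * Tpo s)) s := by
  have h1 := ((((hasDerivAt_id s).mul (Real.hasDerivAt_log hs.ne')).add
    ((hasDerivAt_id s).const_mul (2 * Real.eulerMascheroniConstant - 1))).const_mul Real.pi)
  refine (((hasDerivAt_tsum_log hs).sub h1).sub
    ((Real.hasDerivAt_log hs.ne').const_mul (1 / 2))).congr_deriv ?_
  rw [mul_Tpo hs, two_pi_mul_tsum_dualTerm hs]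
  simp only [id]
  field_simp
  ring

theorem integrableOn_mul_Tpo {s : ℝ} (hs : 0 < s) :
    IntegrableOn (fun k : ℝ => k * Tpo k) (Ioi s) := by
  obtain ⟨C, hC⟩ := exists_norm_mul_Tpo_le
  refine ((integrableOn_Ioi_rpow_of_lt (a := -2) (by norm_num) hs).const_mul C).mono' ?_
    ((ae_restrict_iff' measurableSet_Ioi).mpr (ae_of_all _ fun k hk => hC k (hs.trans hk)))
  -- Measurability of `k T^po(k)` comes for free, as it is half a derivative on this half line.
  refine ((measurable_deriv logZeta).div_const 2).aestronglyMeasurable.congr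
    ((ae_restrict_iff' measurableSet_Ioi).mpr (ae_of_all _ fun k hk => ?_))
  simp only [(hasDerivAt_logZeta (hs.trans hk)).deriv]
  ring

/-- The limit of `logZeta` at infinity exists because its derivative is integrable. Its value is
immaterial: it enters `Z` as a constant factor and drops out of the functional equation. -/
theorem exists_integral_mul_Tpo : ∃ l : ℝ, ∀ s : ℝ, 0 < s →
    -2 * ∫ k in Ioi s, k * Tpo k = logZeta s - l := by
  refine ⟨limUnder atTop logZeta, fun s hs => ?_⟩
  have h1 : ∀ a : ℝ, 0 < a → IntegrableOn (fun k => 2 * (k * Tpo k)) (Ioi a) :=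
    fun a ha => (integrableOn_mul_Tpo ha).const_mul 2
  have h2 := integral_Ioi_of_hasDerivAt_of_tendsto'
    (fun x hx => hasDerivAt_logZeta (hs.trans_le hx)) (h1 s hs)
    (tendsto_limUnder_of_hasDerivAt_of_integrableOn_Ioi
      (fun x hx => hasDerivAt_logZeta (hs.trans hx)) (h1 s hs))
  rw [integral_const_mul] at h2
  linarith

/-! ### The analytic continuation -/

/-- The Weierstraß product over the wavenumbers. -/
def wavenumberProd (s : ℂ) : ℂ := ∏' p, (1 + s ^ 2 / (wavenumber p : ℂ) ^ 2)

theorem wavenumberProd_neg (s : ℂ) : wavenumberProd (-s) = wavenumberProd s := by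
  simp [wavenumberProd]

theorem differentiable_wavenumberProd : Differentiable ℂ wavenumberProd := fun s => by
  have h1 : HasProdLocallyUniformlyOn (fun p (z : ℂ) => 1 + z ^ 2 / (wavenumber p : ℂ) ^ 2)
      wavenumberProd (Metric.ball 0 (‖s‖ + 1)) := by
    refine Summable.hasProdLocallyUniformlyOn_one_add Metric.isOpen_ball
      (summable_sq_div_wavenumber_sq (‖s‖ + 1)) (Eventually.of_forall fun p z hz => ?_)
      fun p => by fun_prop
    rw [norm_div, norm_pow, norm_pow, Complex.norm_real,
      Real.norm_of_nonneg (wavenumber_pos p).le]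
    have h2 : ‖z‖ ≤ ‖s‖ + 1 := (mem_ball_zero_iff.mp hz).le
    gcongr
  refine (TendstoLocallyUniformlyOn.differentiableOn h1 (Eventually.of_forall fun F => ?_)
    Metric.isOpen_ball).differentiableAt (Metric.isOpen_ball.mem_nhds (by simp))
  fun_prop

theorem wavenumberProd_ofReal (s : ℝ) : wavenumberProd s =
    ((Real.exp (∑' p, Real.log (1 + s ^ 2 / wavenumber p ^ 2)) : ℝ) : ℂ) := by
  have h1 := (Real.hasProd_of_hasSum_log
    (fun p => (by positivity : 0 < 1 + s ^ 2 / wavenumber p ^ 2))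
    (summable_log_one_add_sq_div s).hasSum).map Complex.ofRealHom Complex.continuous_ofReal
  refine Eq.trans (congrArg tprod (funext fun p => ?_)) h1.tprod_eq
  simp

/-- The explicit continuation of the zeta function, up to a constant factor. -/
def slitZeta (s : ℂ) : ℂ := wavenumberProd s *
  Complex.exp (-(Real.pi * (s * Complex.log s + (2 * Real.eulerMascheroniConstant - 1) * s))
    - 1 / 2 * Complex.log s)

theorem analyticOnNhd_slitZeta : AnalyticOnNhd ℂ slitZeta Complex.slitPlane := by
  refine DifferentiableOn.analyticOnNhd (fun s hs => ?_) Complex.isOpen_slitPlane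
  have h1 := differentiable_wavenumberProd s
  have h2 := Complex.differentiableAt_log hs
  refine DifferentiableAt.differentiableWithinAt ?_
  unfold slitZeta
  fun_prop

theorem slitZeta_ofReal {s : ℝ} (hs : 0 < s) :
    slitZeta s = ((Real.exp (logZeta s) : ℝ) : ℂ) := by
  rw [slitZeta, wavenumberProd_ofReal, ← Complex.ofReal_log hs.le, Complex.ofReal_exp,
    ← Complex.exp_add, Complex.ofReal_exp, logZeta]
  congr 1
  push_cast
  ring

theorem exists_isPeriodicOrbitZeta_const_mul :
    ∃ c : ℂ, IsPeriodicOrbitZeta fun s => c * slitZeta s := by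
  obtain ⟨l, hl⟩ := exists_integral_mul_Tpo
  refine ⟨((Real.exp (-l) : ℝ) : ℂ), fun s hs => analyticAt_const.mul (analyticOnNhd_slitZeta s hs),
    fun s hs => ?_⟩
  rw [hl s hs, slitZeta_ofReal hs, ← Complex.ofReal_mul, ← Real.exp_add, neg_add_eq_sub]

theorem IsPeriodicOrbitZeta.eqOn {Z W : ℂ → ℂ} (hZ : IsPeriodicOrbitZeta Z)
    (hW : IsPeriodicOrbitZeta W) : EqOn Z W Complex.slitPlane := by
  refine hZ.analytic.eqOn_of_preconnected_of_frequently_eq hW.analytic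
    (Complex.starConvex_one_slitPlane.isPathConnected
      Complex.one_mem_slitPlane).isConnected.isPreconnected Complex.one_mem_slitPlane ?_
  have h1 : Tendsto (fun x : ℝ => (x : ℂ)) (𝓝[>] 1) (𝓝[≠] 1) :=
    tendsto_nhdsWithin_iff.mpr
      ⟨by simpa using (Complex.continuous_ofReal.tendsto 1).mono_left nhdsWithin_le_nhds,
      eventually_mem_nhdsWithin.mono fun x hx => by simpa using (ne_of_gt hx)⟩
  refine h1.frequently (Eventually.frequently (eventually_mem_nhdsWithin.mono fun x hx => ?_))
  have hx0 : (0 : ℝ) < x := one_pos.trans hx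
  rw [hZ.eq_exp x hx0, hW.eq_exp x hx0]

/-! ### The functional equation -/

theorem log_neg_of_im_pos {s : ℂ} (hs : 0 < s.im) :
    Complex.log (-s) = Complex.log s - Real.pi * Complex.I := by
  simp only [Complex.log, Complex.arg_neg_eq_arg_sub_pi_of_im_pos hs, norm_neg]
  push_cast
  ring

/-- Only the logarithm changes, by `-π i`: in the exponent `-π s log s` this adds `-i π² s`, and in
`-(1/2) log s` it adds `i π / 2`. The odd terms double. -/
theorem slitZeta_neg {s : ℂ} (hs : 0 < s.im) :
    slitZeta (-s) = Complex.exp (phi s) * slitZeta s := by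
  rw [slitZeta, slitZeta, wavenumberProd_neg, log_neg_of_im_pos hs, mul_left_comm,
    ← Complex.exp_add, phi]
  congr 2
  ring

theorem IsPeriodicOrbitZeta.neg {Z : ℂ → ℂ} (hZ : IsPeriodicOrbitZeta Z) {s : ℂ}
    (hs : 0 < s.im) : Z (-s) = Complex.exp (phi s) * Z s := by
  obtain ⟨c, hc⟩ := exists_isPeriodicOrbitZeta_const_mul
  have h1 := hZ.eqOn hc
  rw [h1 (Or.inr (by simpa using hs.ne')),
    h1 (Or.inr hs.ne')]
  simp only [slitZeta_neg hs, mul_left_comm]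

/-- The right side of the functional equation is continuous at `k`, an interior point of the slit
plane, although `-k` lies on the cut. -/
theorem IsPeriodicOrbitZeta.tendsto_neg {Z : ℂ → ℂ} (hZ : IsPeriodicOrbitZeta Z) {k : ℝ}
    (hk : 0 < k) : Tendsto (fun s : ℂ => Z (-s)) (𝓝[{s : ℂ | 0 < s.im}] (k : ℂ))
      (𝓝 (Complex.exp (phi (k : ℂ)) * Z (k : ℂ))) := by
  have h1 : (k : ℂ) ∈ Complex.slitPlane := Complex.ofReal_mem_slitPlane.mpr hk
  have h2 : ContinuousAt Complex.log k := continuousAt_clog h1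
  have h3 : ContinuousAt (fun s => Complex.exp (phi s) * Z s) k := by
    refine ContinuousAt.mul ?_ (hZ.analytic k h1).continuousAt
    unfold phi
    fun_prop
  refine (h3.tendsto.mono_left nhdsWithin_le_nhds).congr' ?_
  exact eventually_mem_nhdsWithin.mono fun s hs => (hZ.neg hs).symm

/-- The contribution `-π k / 2` of `log i` cancels against the term `-i (π / 2) s`, leaving a purely
imaginary exponent. -/
theorem phi_I_mul {k : ℝ} (hk : 0 < k) :
    phi (Complex.I * k) = 2 * (Real.pi : ℂ) * Complex.I * (weylN k : ℂ) := by
  have h1 : Complex.log (Complex.I * k) = Real.log k + Real.pi / 2 * Complex.I := by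
    rw [mul_comm, Complex.log_ofReal_mul hk Complex.I_ne_zero, Complex.log_I]
  rw [phi, h1, weylN]
  push_cast
  ring

end DirichletGraph

end

theorem theorem11 :
    -- the integrals and the series that define `Z` on the positive half line converge,
    ((∀ n : ℕ, 1 ≤ n → ∀ k : ℝ, 0 < k →
        IntegrableOn (DirichletGraph.poIntegrand n k) (Ioi (0 : ℝ))) ∧
      (∀ k : ℝ, 0 < k → Summable (fun n : ℕ => DirichletGraph.poTerm n k)) ∧
      (∀ s : ℝ, 0 < s → IntegrableOn (fun k : ℝ => k * DirichletGraph.Tpo k) (Ioi s))) ∧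
    -- `Z` has an analytic continuation to the slit plane,
    (∃ Z : ℂ → ℂ, DirichletGraph.IsPeriodicOrbitZeta Z) ∧
    -- which satisfies the functional equation
    ∀ Z : ℂ → ℂ, DirichletGraph.IsPeriodicOrbitZeta Z →
      -- in the upper half plane,
      (∀ s : ℂ, 0 < s.im → Z (-s) = Complex.exp (DirichletGraph.phi s) * Z s) ∧
      -- on the positive half line, `Z (-k)` being the limit from the upper half plane,
      (∀ k : ℝ, 0 < k →
        Tendsto (fun s : ℂ => Z (-s)) (𝓝[{s : ℂ | 0 < s.im}] (k : ℂ))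
          (𝓝 (Complex.exp (DirichletGraph.phi (k : ℂ)) * Z (k : ℂ)))) ∧
      -- and on the critical line.
      (∀ k : ℝ, 0 < k →
        Z (-(Complex.I * (k : ℂ))) =
          Complex.exp (2 * (Real.pi : ℂ) * Complex.I * (DirichletGraph.weylN k : ℂ)) *
            Z (Complex.I * (k : ℂ))) := by
  refine ⟨⟨fun n hn k hk => DirichletGraph.integrableOn_poIntegrand hn hk,
    fun k hk => DirichletGraph.summable_poTerm hk,
    fun s hs => DirichletGraph.integrableOn_mul_Tpo hs⟩,
    ⟨_, DirichletGraph.exists_isPeriodicOrbitZeta_const_mul.choose_spec⟩,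
    fun Z hZ => ⟨fun s hs => hZ.neg hs, fun k hk => hZ.tendsto_neg hk, fun k hk => ?_⟩⟩
  rw [hZ.neg (by simpa using hk), DirichletGraph.phi_I_mul hk]
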